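/- **Setting.** Fix a countably infinite set of object names, countably many action symbols of arbitrary finite arities (infinitely many of them), and finitely many fluent predicates of arity at most $2$. A ground action is an action symbol applied to object names; a trace is a finite sequence of ground actions; a world $w$ gives every atom $F(\vec n)$ ($\vec n$ object names) a truth value after every trace. A C²-fluent sentence is a sentence over fluents and equality that uses only two variables, with Boolean connectives, $\forall$ and counting quantifiers $\exists^{\le m},\exists^{\ge m}$; quantifiers range over the object names, and distinct names denote distinct objects. A C² basic action theory $\mathcal D$ consists of a finite set $\mathcal D_0$ of C²-fluent sentences, which hold initially, and for every fluent $F$ one successor state axiom $\Box[a]F(\vec x)\equiv\gamma_F^+\vee(F(\vec x)\wedge\neg\gamma_F^-)$, where $\gamma_F^\pm$ are finite disjunctions of formulas $\exists\vec y.(a=A(\vec v)\wedge\varepsilon\wedge\kappa)$ with free variables among $\vec x,a$, such that $\vec v$ contains $\vec y$; $\varepsilon$ (effect descriptor) and $\kappa$ (context condition) are fluent formulas; at most two variables of $\varepsilon$ do not occur in $\vec v$ or occur bound in $\varepsilon$; and $\kappa$ has its free variables in $\vec v$ and at most two bound variables. $\mathcal D$ is acyclic if the graph with an edge $(F,F')$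 whenever $F'$ occurs in an effect descriptor of $F$ is acyclic; $\mathrm{fd}(F)$ is the length of a longest path from $F$. A Golog program $\mathcal G=(\mathcal D,\delta)$ has a program expression $\delta$ built from ground actions $\alpha$ and tests $\phi?$ of C²-fluent sentences by sequence, nondeterministic choice, interleaved concurrency and iteration, with the usual transition relation $\langle z,\rho\rangle\xrightarrow{w}\langle z\cdot\alpha,\rho'\rangle$ and final configurations. It is situation-determined if, in every world satisfying $\mathcal D$, configurations reachable from the same $\langle z,\delta\rangle$ with the same trace have the same remaining program. An execution of $\mathcal G$ in $w\models\mathcal D$ is a trace leading from $\langle\langle\rangle,\delta\rangle$ to a final configuration. A temporal formula $\Phi$ is an LTLf formula ($\neg,\wedge,\mathsf X,\mathsf U$) over C²-fluent sentences. **The arena.** *Characteristic graph.* Its nodes $\mathrm{sub}(\delta)$ are the programs reachable from $\delta$ along edges $\rho\xrightarrow{\alpha/\psi}\rho'$ (action $\alpha$, guard sentence $\psi$), which mirror the transition rules, with finality of a subprogram replaced by its termination condition: $\varphi(\alpha)=\bot$, $\varphi(\phi?)=\phi$, conjunction for sequence and concurrency, disjunction for choice, $\top$ for iteration. *Effects.*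 For a ground action $\alpha$ of $\delta$, instantiating the disjuncts of $\gamma_F^\pm$ by $a=\alpha$ gives finitely many pairs $(\varepsilon,\kappa)$ with $\kappa$ a sentence. Let $\mathrm{eff}^\pm(F)$ be the descriptors $\varepsilon$ so obtained. An effect is $\langle F^-,\varphi\rangle$ or $\langle F^+,\varphi\wedge\bigwedge_{\nu\in N}\neg\nu\rangle$ with a finite set $N$. Regression $\mathcal R[E,\varphi]$ replaces each $F(\vec v)$ in $\varphi$ by $\bigl(F(\vec v)\wedge\bigwedge_{\langle F^-,\varepsilon\rangle\in E}\neg\varepsilon^{\vec x}_{\vec v}\bigr)\vee\bigvee_{\langle F^+,\varepsilon\rangle\in E}\varepsilon^{\vec x}_{\vec v}$. Accumulation $E_0\triangleright E_1$ consists of $\langle F^\pm,\mathcal R[E_0,\varphi]\rangle$ for $\langle F^\pm,\varphi\rangle\in E_1$, of all $\langle F^-,\varphi\rangle\in E_0$, and of $\langle F^+,\varphi\wedge\bigwedge_{\langle F^-,\varphi'\rangle\in E_1}\neg\mathcal R[E_0,\varphi']\rangle$ for $\langle F^+,\varphi\rangle\in E_0$. The relevant effects $\mathfrak E=\bigcup_i\mathfrak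 E_i$ are given by $\mathfrak E_{-1}=\emptyset$ and $$\mathfrak E_i=\mathfrak E_{i-1}\cup\{\langle F^-,\mathcal R[E,\varepsilon]\rangle\}\cup\Bigl\{\Bigl\langle F^+,\mathcal R[E,\phi]\wedge\bigwedge_{(\varepsilon,E')\in X}\neg\mathcal R[E',\varepsilon]\Bigr\rangle\Bigr\},$$ where $F$ ranges over the fluents with $\mathrm{fd}(F)=i$, $\varepsilon\in\mathrm{eff}^-(F)$, $\phi\in\mathrm{eff}^+(F)$, $E\subseteq\mathfrak E_{i-1}$, and $X\subseteq\mathrm{eff}^-(F)\times2^{\mathfrak E_{i-1}}$. Conjunctions over sets do not depend on order or repetition. *Types.* The context $\mathcal C$ consists of the sentences in $\mathcal D_0$, the instantiated $\kappa$, the guards and termination conditions of the characteristic graph, the sentences in $\Phi$, $\top$, and the negations of all these. A type is a set $\tau$ of pairs $(\psi,E)$, $\psi\in\mathcal C$, $E\subseteq\mathfrak E$, such that for each listed sentence $\psi$ and each $E\subseteq\mathfrak E$, $(\psi,E)\in\tau$ or $(\neg\psi,E)\in\tau$, and some world initially satisfies $\mathcal D_0$ and all $\mathcal R[E,\psi]$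 with $(\psi,E)\in\tau$. The type of $w$ is $\{(\psi,E):\psi\in\mathcal C,\,E\subseteq\mathfrak E,\,w\models\mathcal R[E,\psi]\}$. Put $\mathcal E(\tau,E,\alpha)=\{\langle F^\pm,\varepsilon\rangle:(\varepsilon,\kappa)\text{ an instance of }\gamma_F^\pm\text{ by }\alpha,\ (\kappa,E)\in\tau\}$. *Temporal part.* Let $\mathrm{tnf}(\Phi)=t(\Phi')\wedge(\top\,\mathsf U\,\mathit{Tail})$, where $\Phi'$ is the negation normal form of $\Phi$ (with weak next $\mathsf N$ and release $\mathsf R$), $\mathit{Tail}$ is a new atom, $t$ fixes literals, commutes with $\wedge,\vee$, and $t(\mathsf X\Psi)=\neg\mathit{Tail}\wedge\mathsf X\,t(\Psi)$, $t(\mathsf N\Psi)=\mathit{Tail}\vee\mathsf X\,t(\Psi)$, $t(\Phi_1\mathsf U\Phi_2)=(\neg\mathit{Tail}\wedge t(\Phi_1))\,\mathsf U\,t(\Phi_2)$, $t(\Phi_1\mathsf R\Phi_2)=(\mathit{Tail}\vee t(\Phi_1))\,\mathsf R\,t(\Phi_2)$. Further, $\mathrm{xnf}$ fixes literals and $\mathsf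 X$-formulas, commutes with $\wedge,\vee$, and $\mathrm{xnf}(\Phi_1\mathsf U\Phi_2)=\mathrm{xnf}(\Phi_2)\vee(\mathrm{xnf}(\Phi_1)\wedge\mathsf X(\Phi_1\mathsf U\Phi_2))$, $\mathrm{xnf}(\Phi_1\mathsf R\Phi_2)=\mathrm{xnf}(\Phi_2)\wedge(\mathrm{xnf}(\Phi_1)\vee\mathsf X(\Phi_1\mathsf R\Phi_2))$. For a set $C$ of sets of formulas, let $\mathrm{Ob}(\tau,E,C)$ be the set of pairs $(X(P),T(P))$, where $P$ is, for some $\chi\in C$, a partial assignment to the propositional atoms (sentences, $\mathit{Tail}$, $\mathsf X$-formulas) of $\mathrm{xnf}(\bigwedge\chi)$ that satisfies it propositionally, and $(\psi,E)\in\tau$ for every fluent literal $\psi$ of $P$; here $X(P)=\{\Theta: P(\mathsf X\Theta)=1\}$, and $T(P)=\top$ if $P(\mathit{Tail})=1$, $T(P)=\bot$ otherwise. *Arena.* States are quadruples $(\tau,E,A,\rho)$ with $\tau$ a type, $E\subseteq\mathfrak E$, $\rho\in\mathrm{sub}(\delta)$, and $A$ a set of pairs of a set of subformulas of $\mathrm{tnf}(\Phi)$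 and a value in $\{\top,\bot\}$. Initial states are $(\tau,\emptyset,\mathrm{Ob}(\tau,\emptyset,\{\{\mathrm{tnf}(\Phi)\}\}),\delta)$ with $\tau$ the type of some $w\models\mathcal D$. There is a transition $(\tau,E_1,A_1,\rho_1)\xrightarrow{\alpha}(\tau,E_2,A_2,\rho_2)$ iff there is an edge $\rho_1\xrightarrow{\alpha/\psi}\rho_2$ with $(\psi,E_1)\in\tau$, $E_2=E_1\triangleright\mathcal E(\tau,E_1,\alpha)$, and $A_2=\mathrm{Ob}(\tau,E_2,\{\chi:(\chi,\bot)\in A_1\})$. A state is final if $(\varphi(\rho),E)\in\tau$, and accepting if $(\emptyset,\top)\in A$. **Theorem.** Let $\mathcal G=(\mathcal D,\delta)$ be a situation-determined Golog program with an acyclic C² basic action theory, and let $\Phi$ be a temporal formula. Then 1. the game arena has finitely many states; 2. every sentence $\mathcal R[E,\psi]$ with $\psi\in\mathcal C$, $E\subseteq\mathfrak E$ is a C²-fluent sentence (so whether a set of pairs is a type is a question of satisfiability of C²-fluent sentences); 3. every execution of $\mathcal G$, in every world satisfying $\mathcal D$, satisfies $\Phi$ if and only if every final state of the arena that is reachable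 from an initial state is accepting. -/

import Mathlib

/-! ## The logic ES: signatures, traces, worlds, fluent formulas -/

/-- A signature: object names (the standard names of sort object), action function symbols, and the
finitely many fluent predicates (of arity at most two) that have a successor state axiom. -/
structure Signature where
  Obj : Type
  Act : Type
  Flu : Type
  actArity : Act → ℕ
  fluArity : Flu → ℕ
  fluArity_le : ∀ F, fluArity F ≤ 2
  [obj_countable : Countable Obj]
  [obj_infinite : Infinite Obj]
  [act_countable : Countable Act]
  [act_infinite : Infinite Act]
  [flu_fintype : Fintype Flu]

attribute [instance] Signature.obj_countable Signature.obj_infinite Signature.act_countable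
  Signature.act_infinite Signature.flu_fintype

/-- Ground actions, i.e. standard names of sort action. -/
structure GroundAction (S : Signature) where
  act : S.Act
  args : Fin (S.actArity act) → S.Obj

/-- Traces (situations) are finite sequences of ground actions. -/
abbrev Trace (S : Signature) := List (GroundAction S)

/-- A world assigns a truth value to every primitive formula in every situation. -/
abbrev World (S : Signature) := (F : S.Flu) → (Fin (S.fluArity F) → S.Obj) → Trace S → Prop

/-- Terms of sort object: variables (named by natural numbers) and object names. -/
inductive Term (S : Signature) where
  | var (x : ℕ)
  | name (n : S.Obj)

namespace Term
variable {S : Signature}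

def vars : Term S → Finset ℕ
  | var x => {x}
  | name _ => ∅

def eval (e : ℕ → S.Obj) : Term S → S.Obj
  | var x => e x
  | name n => n

end Term

/-- Fluent formulas without terms of sort action, with counting quantifiers. -/
inductive Fml (S : Signature) where
  | top
  | eq (s t : Term S)
  | flu (F : S.Flu) (v : Fin (S.fluArity F) → Term S)
  | neg (φ : Fml S)
  | and (φ ψ : Fml S)
  | all (x : ℕ) (φ : Fml S)
  | atMost (m : ℕ) (x : ℕ) (φ : Fml S)
  | atLeast (m : ℕ) (x : ℕ) (φ : Fml S)

namespace Fml
variable {S : Signature}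

def bot : Fml S := neg top

def or (φ ψ : Fml S) : Fml S := neg (and (neg φ) (neg ψ))

/-- Free variables. -/
def fv : Fml S → Finset ℕ
  | top => ∅
  | eq s t => s.vars ∪ t.vars
  | flu _ v => Finset.univ.biUnion fun i => (v i).vars
  | neg φ => φ.fv
  | and φ ψ => φ.fv ∪ ψ.fv
  | all x φ => φ.fv.erase x
  | atMost _ x φ => φ.fv.erase x
  | atLeast _ x φ => φ.fv.erase x

/-- Variables that occur bound. -/
def bv : Fml S → Finset ℕ
  | top => ∅
  | eq _ _ => ∅
  | flu _ _ => ∅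
  | neg φ => φ.bv
  | and φ ψ => φ.bv ∪ ψ.bv
  | all x φ => insert x φ.bv
  | atMost _ x φ => insert x φ.bv
  | atLeast _ x φ => insert x φ.bv

/-- All variables of a formula. -/
def vars (φ : Fml S) : Finset ℕ := φ.fv ∪ φ.bv

/-- The fluents that occur in a formula. -/
def fluents : Fml S → Set S.Flu
  | top => ∅
  | eq _ _ => ∅
  | flu F _ => {F}
  | neg φ => φ.fluents
  | and φ ψ => φ.fluents ∪ ψ.fluents
  | all _ φ => φ.fluents
  | atMost _ _ φ => φ.fluents
  | atLeast _ _ φ => φ.fluents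

/-- C²-fluent sentences: no free variables, and only the two variables `0` and `1` are used. -/
def IsC2Sentence (φ : Fml S) : Prop := φ.fv = ∅ ∧ φ.vars ⊆ {0, 1}

/-- Truth in world `w` and situation `z` under the variable assignment `e`. -/
def Holds (w : World S) (z : Trace S) : (ℕ → S.Obj) → Fml S → Prop
  | _, top => True
  | e, eq s t => s.eval e = t.eval e
  | e, flu F v => w F (fun i => (v i).eval e) z
  | e, neg φ => ¬ Holds w z e φ
  | e, and φ ψ => Holds w z e φ ∧ Holds w z e ψ
  | e, all x φ => ∀ n, Holds w z (Function.update e x n) φ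
  | e, atMost m x φ => {n | Holds w z (Function.update e x n) φ}.encard ≤ m
  | e, atLeast m x φ => (m : ℕ∞) ≤ {n | Holds w z (Function.update e x n) φ}.encard

/-- Truth of a sentence. -/
def Sat (w : World S) (z : Trace S) (φ : Fml S) : Prop := ∀ e, Holds w z e φ

/-- The bound variable that is used when a substitution `σ` passes a quantifier over `x`: the least
variable that captures nothing. -/
noncomputable def freshFor (σ : ℕ → Term S) (x : ℕ) (φ : Fml S) : ℕ :=
  sInf {j : ℕ | j ∉ (φ.fv.erase x).biUnion fun y => (σ y).vars}

/-- Simultaneous capture-avoiding substitution. A formula with two variables stays one as long as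
the substituted terms use no further variables. -/
noncomputable def subst : (ℕ → Term S) → Fml S → Fml S
  | _, top => top
  | σ, eq s t => eq (tm σ s) (tm σ t)
  | σ, flu F v => flu F fun i => tm σ (v i)
  | σ, neg φ => neg (subst σ φ)
  | σ, and φ ψ => and (subst σ φ) (subst σ ψ)
  | σ, all x φ =>
      all (freshFor σ x φ) (subst (Function.update σ x (.var (freshFor σ x φ))) φ)
  | σ, atMost m x φ =>
      atMost m (freshFor σ x φ) (subst (Function.update σ x (.var (freshFor σ x φ))) φ)
  | σ, atLeast m x φ =>
      atLeast m (freshFor σ x φ) (subst (Function.update σ x (.var (freshFor σ x φ))) φ)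
where
  tm (σ : ℕ → Term S) : Term S → Term S
    | .var x => σ x
    | .name n => .name n

/-- Conjunction of a finite set of formulas (in some fixed order). -/
noncomputable def bigAnd (s : Finset (Fml S)) : Fml S := s.toList.foldr and top

/-- Disjunction of a finite set of formulas (in some fixed order). -/
noncomputable def bigOr (s : Finset (Fml S)) : Fml S := s.toList.foldr or bot

end Fml

/-! ## Basic action theories -/

/-- A disjunct `∃ y⃗. (a = A(v⃗) ∧ ε ∧ κ)` of an effect condition of a fluent with formal arguments
`x⃗`, which are the variables `0, …, k - 1`. The quantified variables `y⃗` are the variables of `v⃗`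
that are not among `x⃗`. -/
structure Disjunct (S : Signature) (k : ℕ) where
  act : S.Act
  args : Fin (S.actArity act) → Term S
  eff : Fml S
  ctx : Fml S
  eff_fv : eff.fv ⊆ Finset.range k ∪ Finset.univ.biUnion fun j => (args j).vars
  eff_two : ((eff.vars \ Finset.univ.biUnion fun j => (args j).vars) ∪ eff.bv).card ≤ 2
  ctx_fv : ctx.fv ⊆ Finset.univ.biUnion fun j => (args j).vars
  ctx_two : ctx.bv.card ≤ 2

namespace Disjunct
variable {S : Signature} {k : ℕ}

def argVars (d : Disjunct S k) : Finset ℕ := Finset.univ.biUnion fun j => (d.args j).vars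

/-- The action `A(v⃗)` under a variable assignment. -/
def action (d : Disjunct S k) (e : ℕ → S.Obj) : GroundAction S :=
  ⟨d.act, fun j => (d.args j).eval e⟩

/-- Truth of `∃ y⃗. (a = A(v⃗) ∧ ε ∧ κ)` with `a` being `α` and `x⃗` being `n⃗`. -/
def Holds (w : World S) (z : Trace S) (α : GroundAction S) (n : Fin k → S.Obj)
    (d : Disjunct S k) : Prop :=
  ∃ e : ℕ → S.Obj, (∀ i : Fin k, e i = n i) ∧ α = d.action e ∧
    Fml.Holds w z e d.eff ∧ Fml.Holds w z e d.ctx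

open Classical in
/-- Instantiation of a disjunct by a ground action `α`. It is undefined if `α` is not an instance of
`A(v⃗)`. Otherwise the variables of `v⃗` are replaced by the arguments of `α`, where for every formal
argument `x` in `v⃗` the equation of `x` with that argument is kept in the effect descriptor. -/
noncomputable def ground (d : Disjunct S k) (α : GroundAction S) : Option (Fml S × Fml S) :=
  if h : ∃ e, α = d.action e then
    let σ : ℕ → Term S := fun x => if x ∈ d.argVars then .name (h.choose x) else .var x
    some (((List.range k).filter (· ∈ d.argVars)).foldr
        (fun x φ => .and (.eq (.var x) (.name (h.choose x))) φ) (d.eff.subst σ),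
      d.ctx.subst σ)
  else none

end Disjunct

/-- A basic action theory over C²: an initial theory, and for every fluent `F` the positive and the
negative effect condition of its successor state axiom, as lists of disjuncts. -/
structure BAT (S : Signature) where
  initial : Finset (Fml S)
  initial_c2 : ∀ φ ∈ initial, φ.IsC2Sentence
  pos : (F : S.Flu) → List (Disjunct S (S.fluArity F))
  neg : (F : S.Flu) → List (Disjunct S (S.fluArity F))

namespace BAT
variable {S : Signature} (D : BAT S)

/-- `w ⊨ D`: the initial theory holds initially, and all successor state axioms
`□ [a] F(x⃗) ≡ γ⁺ ∨ F(x⃗) ∧ ¬ γ⁻` hold. -/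
def Models (w : World S) : Prop :=
  (∀ φ ∈ D.initial, φ.Sat w []) ∧
  ∀ (z : Trace S) (α : GroundAction S) (F : S.Flu) (n : Fin (S.fluArity F) → S.Obj),
    w F n (z ++ [α]) ↔
      (∃ d ∈ D.pos F, d.Holds w z α n) ∨ (w F n z ∧ ¬ ∃ d ∈ D.neg F, d.Holds w z α n)

/-- The edges of the fluent dependency graph. -/
def Dep (F F' : S.Flu) : Prop := ∃ d, (d ∈ D.pos F ∨ d ∈ D.neg F) ∧ F' ∈ d.eff.fluents

def Acyclic : Prop := ∀ F, ¬ Relation.TransGen D.Dep F F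

/-- The length of the longest path in the dependency graph that starts in `F`. -/
noncomputable def fluentDepth (F : S.Flu) : ℕ :=
  sSup {n | ∃ l : List S.Flu, List.IsChain D.Dep (F :: l) ∧ l.length = n}

/-- The length of the longest path in the dependency graph. -/
noncomputable def depth : ℕ := Finset.univ.sup D.fluentDepth

/-- The instantiated positive effect condition, as a list of pairs `(ε, κ)`. -/
noncomputable def groundPos (F : S.Flu) (α : GroundAction S) : List (Fml S × Fml S) :=
  (D.pos F).filterMap fun d => d.ground α

/-- The instantiated negative effect condition, as a list of pairs `(ε, κ)`. -/
noncomputable def groundNeg (F : S.Flu) (α : GroundAction S) : List (Fml S × Fml S) :=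
  (D.neg F).filterMap fun d => d.ground α

end BAT

/-! ## Golog programs -/

inductive Prog (S : Signature) where
  | act (α : GroundAction S)
  | test (φ : Fml S)
  | seq (δ₁ δ₂ : Prog S)
  | choice (δ₁ δ₂ : Prog S)
  | par (δ₁ δ₂ : Prog S)
  | star (δ : Prog S)

namespace Prog
variable {S : Signature}

/-- The empty program. -/
def nil : Prog S := test .top

/-- The ground actions that occur in a program. -/
def actions : Prog S → Set (GroundAction S)
  | act α => {α}
  | test _ => ∅
  | seq δ₁ δ₂ => δ₁.actions ∪ δ₂.actions
  | choice δ₁ δ₂ => δ₁.actions ∪ δ₂.actions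
  | par δ₁ δ₂ => δ₁.actions ∪ δ₂.actions
  | star δ => δ.actions

/-- All tests are C²-fluent sentences. -/
def TestsC2 : Prog S → Prop
  | act _ => True
  | test φ => φ.IsC2Sentence
  | seq δ₁ δ₂ => δ₁.TestsC2 ∧ δ₂.TestsC2
  | choice δ₁ δ₂ => δ₁.TestsC2 ∧ δ₂.TestsC2
  | par δ₁ δ₂ => δ₁.TestsC2 ∧ δ₂.TestsC2
  | star δ => δ.TestsC2

/-- Final configurations. -/
inductive Final (w : World S) : Trace S → Prog S → Prop
  | test {z φ} : φ.Sat w z → Final w z (test φ)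
  | seq {z δ₁ δ₂} : Final w z δ₁ → Final w z δ₂ → Final w z (seq δ₁ δ₂)
  | choice_left {z δ₁ δ₂} : Final w z δ₁ → Final w z (choice δ₁ δ₂)
  | choice_right {z δ₁ δ₂} : Final w z δ₂ → Final w z (choice δ₁ δ₂)
  | par {z δ₁ δ₂} : Final w z δ₁ → Final w z δ₂ → Final w z (par δ₁ δ₂)
  | star {z δ} : Final w z (star δ)

/-- The transition relation among configurations. -/
inductive Trans (w : World S) : Trace S × Prog S → Trace S × Prog S → Prop
  | act {z α} : Trans w (z, act α) (z ++ [α], nil)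
  | seq_left {z z' δ₁ δ₂ ρ} : Trans w (z, δ₁) (z', ρ) → Trans w (z, seq δ₁ δ₂) (z', seq ρ δ₂)
  | seq_right {z z' δ₁ δ₂ ρ} : Final w z δ₁ → Trans w (z, δ₂) (z', ρ) →
      Trans w (z, seq δ₁ δ₂) (z', ρ)
  | choice_left {z z' δ₁ δ₂ ρ} : Trans w (z, δ₁) (z', ρ) → Trans w (z, choice δ₁ δ₂) (z', ρ)
  | choice_right {z z' δ₁ δ₂ ρ} : Trans w (z, δ₂) (z', ρ) → Trans w (z, choice δ₁ δ₂) (z', ρ)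
  | par_left {z z' δ₁ δ₂ ρ} : Trans w (z, δ₁) (z', ρ) → Trans w (z, par δ₁ δ₂) (z', par ρ δ₂)
  | par_right {z z' δ₁ δ₂ ρ} : Trans w (z, δ₂) (z', ρ) → Trans w (z, par δ₁ δ₂) (z', par δ₁ ρ)
  | star {z z' δ ρ} : Trans w (z, δ) (z', ρ) → Trans w (z, star δ) (z', seq ρ (star δ))

/-- The set of traces that lead from `⟨z, δ⟩` to a final configuration. -/
def traces (w : World S) (z : Trace S) (δ : Prog S) : Set (Trace S) :=
  {z' | ∃ ρ, Relation.ReflTransGen (Trans w) (z, δ) (z ++ z', ρ) ∧ Final w (z ++ z') ρ}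

/-- The termination condition of a program. -/
def term : Prog S → Fml S
  | act _ => .bot
  | test φ => φ
  | seq δ₁ δ₂ => .and δ₁.term δ₂.term
  | choice δ₁ δ₂ => .or δ₁.term δ₂.term
  | par δ₁ δ₂ => .and δ₁.term δ₂.term
  | star _ => .top

/-- The edges of characteristic graphs: `Edge δ α ψ ρ` is the edge from `δ` to `ρ` with action `α`
and guard `ψ`. -/
inductive Edge : Prog S → GroundAction S → Fml S → Prog S → Prop
  | act {α} : Edge (act α) α .top nil
  | seq_left {δ₁ δ₂ α ψ ρ} : Edge δ₁ α ψ ρ → Edge (seq δ₁ δ₂) α ψ (seq ρ δ₂)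
  | seq_right {δ₁ δ₂ α ψ ρ} : Edge δ₂ α ψ ρ → Edge (seq δ₁ δ₂) α (.and δ₁.term ψ) ρ
  | choice_left {δ₁ δ₂ α ψ ρ} : Edge δ₁ α ψ ρ → Edge (choice δ₁ δ₂) α ψ ρ
  | choice_right {δ₁ δ₂ α ψ ρ} : Edge δ₂ α ψ ρ → Edge (choice δ₁ δ₂) α ψ ρ
  | par_left {δ₁ δ₂ α ψ ρ} : Edge δ₁ α ψ ρ → Edge (par δ₁ δ₂) α ψ (par ρ δ₂)
  | par_right {δ₁ δ₂ α ψ ρ} : Edge δ₂ α ψ ρ → Edge (par δ₁ δ₂) α ψ (par δ₁ ρ)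
  | star {δ α ψ ρ} : Edge δ α ψ ρ → Edge (star δ) α ψ (seq ρ (star δ))

/-- The nodes of the characteristic graph of `δ`: the subprograms reachable from `δ`. -/
def sub (δ : Prog S) : Set (Prog S) :=
  {ρ | Relation.ReflTransGen (fun ρ₁ ρ₂ => ∃ α ψ, Edge ρ₁ α ψ ρ₂) δ ρ}

end Prog

/-- A Golog program `(D, δ)`. -/
structure GologProgram (S : Signature) where
  bat : BAT S
  prog : Prog S
  tests_c2 : prog.TestsC2

/-- Situation-determined programs: the performed actions determine the remaining program. -/
def GologProgram.SituationDetermined {S : Signature} (G : GologProgram S) : Prop :=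
  ∀ w, G.bat.Models w → ∀ (z z' : Trace S) (δ' δ'' : Prog S),
    Relation.ReflTransGen (Prog.Trans w) (z, G.prog) (z', δ') →
    Relation.ReflTransGen (Prog.Trans w) (z, G.prog) (z', δ'') → δ' = δ''

/-! ## Temporal formulas and their normal forms -/

/-- LTLf formulas over fluent sentences. -/
inductive Goal (S : Signature) where
  | atom (φ : Fml S)
  | neg (Φ : Goal S)
  | and (Φ Ψ : Goal S)
  | next (Φ : Goal S)
  | untl (Φ Ψ : Goal S)

namespace Goal
variable {S : Signature}

/-- All atoms are C²-fluent sentences. -/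
def IsC2 : Goal S → Prop
  | atom φ => φ.IsC2Sentence
  | neg Φ => Φ.IsC2
  | and Φ Ψ => Φ.IsC2 ∧ Ψ.IsC2
  | next Φ => Φ.IsC2
  | untl Φ Ψ => Φ.IsC2 ∧ Ψ.IsC2

/-- `w, z, z' ⊨ Φ`: truth after the situation `z` with `z'` as the remaining trace. -/
def Sat (w : World S) : Trace S → Trace S → Goal S → Prop
  | z, _, atom φ => φ.Sat w z
  | z, z', neg Φ => ¬ Sat w z z' Φ
  | z, z', and Φ Ψ => Sat w z z' Φ ∧ Sat w z z' Ψ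
  | z, z', next Φ => ∃ α z'', z' = α :: z'' ∧ Sat w (z ++ [α]) z'' Φ
  | z, z', untl Φ Ψ => ∃ k ≤ z'.length, Sat w (z ++ z'.take k) (z'.drop k) Ψ ∧
      ∀ i < k, Sat w (z ++ z'.take i) (z'.drop i) Φ

end Goal

/-- Temporal formulas in negation normal form. -/
inductive NNF (S : Signature) where
  | lit (φ : Fml S)
  | nlit (φ : Fml S)
  | and (Φ Ψ : NNF S)
  | or (Φ Ψ : NNF S)
  | next (Φ : NNF S)
  | wnext (Φ : NNF S)
  | untl (Φ Ψ : NNF S)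
  | rels (Φ Ψ : NNF S)

/-- `Φ.nnf true` is the negation normal form of `Φ`, and `Φ.nnf false` that of its negation. -/
def Goal.nnf {S : Signature} : Bool → Goal S → NNF S
  | true, .atom φ => .lit φ
  | false, .atom φ => .nlit φ
  | b, .neg Φ => Φ.nnf (!b)
  | true, .and Φ Ψ => .and (Φ.nnf true) (Ψ.nnf true)
  | false, .and Φ Ψ => .or (Φ.nnf false) (Ψ.nnf false)
  | true, .next Φ => .next (Φ.nnf true)
  | false, .next Φ => .wnext (Φ.nnf false)
  | true, .untl Φ Ψ => .untl (Φ.nnf true) (Ψ.nnf true)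
  | false, .untl Φ Ψ => .rels (Φ.nnf false) (Ψ.nnf false)

/-- Temporal formulas in the syntax of tail normal forms: negation normal form without weak next,
and with the literals `Tail` and `¬ Tail`. -/
inductive TNF (S : Signature) where
  | lit (φ : Fml S)
  | nlit (φ : Fml S)
  | tail
  | ntail
  | and (Φ Ψ : TNF S)
  | or (Φ Ψ : TNF S)
  | next (Φ : TNF S)
  | untl (Φ Ψ : TNF S)
  | rels (Φ Ψ : TNF S)

/-- The recursive part `t(Φ)` of the tail normal form. -/
def NNF.toTNF {S : Signature} : NNF S → TNF S
  | .lit φ => .lit φ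
  | .nlit φ => .nlit φ
  | .and Φ Ψ => .and Φ.toTNF Ψ.toTNF
  | .or Φ Ψ => .or Φ.toTNF Ψ.toTNF
  | .next Φ => .and .ntail (.next Φ.toTNF)
  | .wnext Φ => .or .tail (.next Φ.toTNF)
  | .untl Φ Ψ => .untl (.and .ntail Φ.toTNF) Ψ.toTNF
  | .rels Φ Ψ => .rels (.or .tail Φ.toTNF) Ψ.toTNF

/-- The tail normal form `t(Φ) ∧ F Tail`. -/
def Goal.tnf {S : Signature} (Φ : Goal S) : TNF S :=
  .and (Φ.nnf true).toTNF (.untl (.lit .top) .tail)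

namespace TNF
variable {S : Signature}

/-- The set of subformulas. -/
def cl : TNF S → Set (TNF S)
  | lit φ => {lit φ}
  | nlit φ => {nlit φ, lit φ}
  | tail => {tail}
  | ntail => {ntail, tail}
  | and Φ Ψ => {and Φ Ψ} ∪ Φ.cl ∪ Ψ.cl
  | or Φ Ψ => {or Φ Ψ} ∪ Φ.cl ∪ Ψ.cl
  | next Φ => {next Φ} ∪ Φ.cl
  | untl Φ Ψ => {untl Φ Ψ} ∪ Φ.cl ∪ Ψ.cl
  | rels Φ Ψ => {rels Φ Ψ} ∪ Φ.cl ∪ Ψ.cl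

/-- The fluent sentences that occur as atoms. -/
def sentences : TNF S → Set (Fml S)
  | lit φ => {φ}
  | nlit φ => {φ}
  | tail => ∅
  | ntail => ∅
  | and Φ Ψ => Φ.sentences ∪ Ψ.sentences
  | or Φ Ψ => Φ.sentences ∪ Ψ.sentences
  | next Φ => Φ.sentences
  | untl Φ Ψ => Φ.sentences ∪ Ψ.sentences
  | rels Φ Ψ => Φ.sentences ∪ Ψ.sentences

/-- NeXt normal form. -/
def xnf : TNF S → TNF S
  | lit φ => lit φ
  | nlit φ => nlit φ
  | tail => tail
  | ntail => ntail
  | and Φ Ψ => and Φ.xnf Ψ.xnf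
  | or Φ Ψ => or Φ.xnf Ψ.xnf
  | next Φ => next Φ
  | untl Φ Ψ => or Ψ.xnf (and Φ.xnf (next (untl Φ Ψ)))
  | rels Φ Ψ => and Ψ.xnf (or Φ.xnf (next (rels Φ Ψ)))

/-- Propositional atoms. -/
def propAtoms : TNF S → Set (TNF S)
  | lit φ => {lit φ}
  | nlit φ => {lit φ}
  | tail => {tail}
  | ntail => {tail}
  | and Φ Ψ => Φ.propAtoms ∪ Ψ.propAtoms
  | or Φ Ψ => Φ.propAtoms ∪ Ψ.propAtoms
  | next Φ => {next Φ}
  | untl Φ Ψ => {untl Φ Ψ}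
  | rels Φ Ψ => {rels Φ Ψ}

/-- A partial assignment `P` (defined on propositional atoms) satisfies a formula that is understood
as a propositional formula. -/
def PropSat (P : TNF S → Option Bool) : TNF S → Prop
  | lit φ => P (lit φ) = some true
  | nlit φ => P (lit φ) = some false
  | tail => P tail = some true
  | ntail => P tail = some false
  | and Φ Ψ => PropSat P Φ ∧ PropSat P Ψ
  | or Φ Ψ => PropSat P Φ ∨ PropSat P Ψ
  | next Φ => P (next Φ) = some true
  | untl Φ Ψ => P (untl Φ Ψ) = some true
  | rels Φ Ψ => P (rels Φ Ψ) = some true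

/-- `P` is a satisfying propositional assignment of `xnf(⋀ χ)`. -/
def IsAssignment (χ : Set (TNF S)) (P : TNF S → Option Bool) : Prop :=
  (∀ a, P a ≠ none → ∃ Θ ∈ χ, a ∈ Θ.xnf.propAtoms) ∧ ∀ Θ ∈ χ, PropSat P Θ.xnf

/-- `L(P)`: the fluent literals of `P`. -/
def localPart (P : TNF S → Option Bool) : Set (Fml S) :=
  {ψ | P (lit ψ) = some true} ∪ {ψ | ∃ φ, P (lit φ) = some false ∧ ψ = .neg φ}

/-- `X(P)`: what has to hold in the next state according to `P`. -/
def nextPart (P : TNF S → Option Bool) : Set (TNF S) := {Θ | P (next Θ) = some true}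

/-- `T(P)`: whether `P` makes `Tail` true. -/
def tailPart (P : TNF S → Option Bool) : Bool := decide (P tail = some true)

end TNF

/-! ## Effects, regression, accumulation -/

/-- Effects. `del F φ` is `⟨F⁻, φ⟩`, and `add F φ N` is `⟨F⁺, φ ∧ ⋀_{ν ∈ N} ¬ ν⟩`; the conjuncts are
kept as a set, so that repeating or reordering them does not make a new effect. -/
inductive Effect (S : Signature) where
  | add (F : S.Flu) (φ : Fml S) (N : Finset (Fml S))
  | del (F : S.Flu) (φ : Fml S)

section Effects
open Classical
variable {S : Signature}

/-- The descriptors of the negative effects on `F` in `E`. -/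
noncomputable def delDescr (E : Finset (Effect S)) (F : S.Flu) : Finset (Fml S) :=
  E.biUnion fun
    | .add _ _ _ => ∅
    | .del F' φ => if F' = F then {φ} else ∅

/-- The descriptors of the positive effects on `F` in `E`. -/
noncomputable def addDescr (E : Finset (Effect S)) (F : S.Flu) : Finset (Fml S) :=
  E.biUnion fun
    | .add F' φ N => if F' = F then {.and φ (.bigAnd (N.image .neg))} else ∅
    | .del _ _ => ∅

/-- Replace the formal arguments of `F` (the variables `0, …, k - 1`) by `v`. -/
noncomputable def substArgs {k : ℕ} (v : Fin k → Term S) (φ : Fml S) : Fml S :=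
  φ.subst fun x => if h : x < k then v ⟨x, h⟩ else .var x

/-- The regression `R[E, φ]` of a formula through a set of effects. -/
noncomputable def regress (E : Finset (Effect S)) : Fml S → Fml S
  | .top => .top
  | .eq s t => .eq s t
  | .flu F v =>
      .or (.and (.flu F v) (.bigAnd ((delDescr E F).image fun ε => .neg (substArgs v ε))))
        (.bigOr ((addDescr E F).image (substArgs v)))
  | .neg φ => .neg (regress E φ)
  | .and φ ψ => .and (regress E φ) (regress E ψ)
  | .all x φ => .all x (regress E φ)
  | .atMost m x φ => .atMost m x (regress E φ)
  | .atLeast m x φ => .atLeast m x (regress E φ)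

/-- The accumulation `E₀ ▷ E₁`. -/
noncomputable def accumulate (E₀ E₁ : Finset (Effect S)) : Finset (Effect S) :=
  (E₁.image fun
    | .add F φ N => .add F (regress E₀ φ) (N.image (regress E₀))
    | .del F φ => .del F (regress E₀ φ)) ∪
  (E₀.image fun
    | .add F φ N => .add F φ (N ∪ (delDescr E₁ F).image (regress E₀))
    | .del F φ => .del F φ)

end Effects

namespace GologProgram
variable {S : Signature} (G : GologProgram S)

/-- Positive effect descriptors of `F`, for the ground actions of the program. -/
def effPos (F : S.Flu) : Set (Fml S) :=
  {ε | ∃ α ∈ G.prog.actions, ∃ κ, (ε, κ) ∈ G.bat.groundPos F α}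

/-- Negative effect descriptors of `F`, for the ground actions of the program. -/
def effNeg (F : S.Flu) : Set (Fml S) :=
  {ε | ∃ α ∈ G.prog.actions, ∃ κ, (ε, κ) ∈ G.bat.groundNeg F α}

open Classical in
/-- The relevant effects on the fluents of depth smaller than `i`. For depth `0` the descriptors
mention no fluents, and `R[∅, ε]` is `ε`. -/
def relEffectsBelow : ℕ → Set (Effect S)
  | 0 => ∅
  | i + 1 => relEffectsBelow i ∪
      {e | ∃ F, G.bat.fluentDepth F = i ∧ ∃ ε ∈ G.effNeg F,
        ∃ E : Finset (Effect S), ↑E ⊆ relEffectsBelow i ∧ e = .del F (regress E ε)} ∪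
      {e | ∃ F, G.bat.fluentDepth F = i ∧ ∃ φ ∈ G.effPos F,
        ∃ E : Finset (Effect S), ↑E ⊆ relEffectsBelow i ∧
        ∃ X : Finset (Fml S × Finset (Effect S)),
          (∀ p ∈ X, p.1 ∈ G.effNeg F ∧ ↑p.2 ⊆ relEffectsBelow i) ∧
          e = .add F (regress E φ) (X.image fun p => regress p.2 p.1)}

/-- The set of all relevant effects. -/
def relEffects : Set (Effect S) := G.relEffectsBelow (G.bat.depth + 1)

/-- The sentences of the initial theory, of the instantiated context conditions, of the termination
conditions and guards of the characteristic graph, and of the temporal formula. -/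
def contextBase (Φ : Goal S) : Set (Fml S) :=
  {ψ | ψ ∈ G.bat.initial} ∪
  {ψ | ∃ F, ∃ α ∈ G.prog.actions, ∃ ε,
    (ε, ψ) ∈ G.bat.groundPos F α ∨ (ε, ψ) ∈ G.bat.groundNeg F α} ∪
  {ψ | ∃ ρ ∈ G.prog.sub, ψ = ρ.term} ∪
  {ψ | ∃ ρ ∈ G.prog.sub, ∃ α ρ', Prog.Edge ρ α ψ ρ'} ∪
  Φ.tnf.sentences

/-- The context of the program: the above sentences and their negations. -/
def context (Φ : Goal S) : Set (Fml S) :=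
  G.contextBase Φ ∪ {ψ | ∃ φ ∈ G.contextBase Φ, ψ = .neg φ}

/-- The set of all type elements. -/
def typeElements (Φ : Goal S) : Set (Fml S × Finset (Effect S)) :=
  {p | p.1 ∈ G.context Φ ∧ ↑p.2 ⊆ G.relEffects}

/-- Types. -/
def IsType (Φ : Goal S) (τ : Set (Fml S × Finset (Effect S))) : Prop :=
  τ ⊆ G.typeElements Φ ∧
  (∀ ψ ∈ G.contextBase Φ, ∀ E : Finset (Effect S), ↑E ⊆ G.relEffects →
    (ψ, E) ∈ τ ∨ (.neg ψ, E) ∈ τ) ∧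
  ∃ w : World S, (∀ φ ∈ G.bat.initial, φ.Sat w []) ∧ ∀ p ∈ τ, (regress p.2 p.1).Sat w []

/-- The type of a world. -/
def typeOf (Φ : Goal S) (w : World S) : Set (Fml S × Finset (Effect S)) :=
  {p | p ∈ G.typeElements Φ ∧ (regress p.2 p.1).Sat w []}

open Classical in
/-- The effects of executing the action `α` in `(τ, E)`. -/
noncomputable def execEffects (τ : Set (Fml S × Finset (Effect S))) (E : Finset (Effect S))
    (α : GroundAction S) : Finset (Effect S) :=
  Finset.univ.biUnion fun F =>
    (((G.bat.groundPos F α).toFinset.filter fun p => (p.2, E) ∈ τ).image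
      fun p => Effect.add F p.1 ∅) ∪
    (((G.bat.groundNeg F α).toFinset.filter fun p => (p.2, E) ∈ τ).image
      fun p => Effect.del F p.1)

end GologProgram

/-! ## The game arena -/

/-- Quadruples `(τ, E, A, ρ)`. -/
structure ArenaState (S : Signature) where
  ty : Set (Fml S × Finset (Effect S))
  eff : Finset (Effect S)
  obl : Set (Set (TNF S) × Bool)
  prog : Prog S

/-- The pairs `(X(P), T(P))` for all satisfying propositional assignments `P` of `xnf(⋀ χ)`, for some
`χ` in the given collection, whose local part `L(P)` holds according to `(τ, E)`. -/
def obligations {S : Signature} (τ : Set (Fml S × Finset (Effect S))) (E : Finset (Effect S))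
    (C : Set (Set (TNF S))) : Set (Set (TNF S) × Bool) :=
  {a | ∃ χ ∈ C, ∃ P : TNF S → Option Bool, TNF.IsAssignment χ P ∧
    (∀ ψ ∈ TNF.localPart P, (ψ, E) ∈ τ) ∧ a = (TNF.nextPart P, TNF.tailPart P)}

namespace GologProgram
variable {S : Signature} (G : GologProgram S) (Φ : Goal S)

/-- The states of the game arena. -/
def IsState (s : ArenaState S) : Prop :=
  G.IsType Φ s.ty ∧ s.prog ∈ G.prog.sub ∧ ↑s.eff ⊆ G.relEffects ∧ ∀ a ∈ s.obl, a.1 ⊆ Φ.tnf.cl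

/-- The initial states of the game arena. -/
def IsInitialState (s : ArenaState S) : Prop :=
  G.IsState Φ s ∧ (∃ w, G.bat.Models w ∧ s.ty = G.typeOf Φ w) ∧ s.prog = G.prog ∧ s.eff = ∅ ∧
    s.obl = obligations s.ty s.eff {{Φ.tnf}}

/-- The transitions of the game arena. -/
def ArenaTrans (s₁ : ArenaState S) (α : GroundAction S) (s₂ : ArenaState S) : Prop :=
  G.IsState Φ s₁ ∧ G.IsState Φ s₂ ∧ s₁.ty = s₂.ty ∧
  (∃ ψ, Prog.Edge s₁.prog α ψ s₂.prog ∧ (ψ, s₁.eff) ∈ s₁.ty) ∧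
  s₂.eff = accumulate s₁.eff (G.execEffects s₁.ty s₁.eff α) ∧
  s₂.obl = obligations s₂.ty s₂.eff {χ | (χ, false) ∈ s₁.obl}

/-- States that are reachable from an initial state. -/
def IsReachable (s : ArenaState S) : Prop :=
  ∃ s₀, G.IsInitialState Φ s₀ ∧
    Relation.ReflTransGen (fun s₁ s₂ => ∃ α, G.ArenaTrans Φ s₁ α s₂) s₀ s

end GologProgram

namespace ArenaState
variable {S : Signature}

/-- Final states: the program may terminate. -/
def IsFinal (s : ArenaState S) : Prop := (s.prog.term, s.eff) ∈ s.ty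

/-- Accepting states. -/
def IsAccepting (s : ArenaState S) : Prop := (∅, true) ∈ s.obl

end ArenaState

/-- Every execution of the program, in every world that satisfies its basic action theory, satisfies
the temporal formula. -/
def GologProgram.AllExecutionsSatisfy {S : Signature} (G : GologProgram S) (Φ : Goal S) : Prop :=
  ∀ w, G.bat.Models w → ∀ z ∈ Prog.traces w [] G.prog, Φ.Sat w [] z

/-!
The arena is a finite abstraction of the configurations that are reachable in the models of the
action theory. A state with type `τ` and effects `E` represents the configurations of a world `w` of
type `τ` after a trace `z` such that the effects `E` turn the initial situation of `w` into the
situation `z` (`GologProgram.Represents`).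

Semantically, a set `E` of effects is the map `applyEffects E` on worlds. Regression through `E` is
evaluation after that map (`holds_regress`), and accumulation is composition of such maps
(`applyEffects_accumulate`). Since the successor state axioms say that an action has exactly the
effects selected by the true context conditions (`GologProgram.applyEffects_execEffects`), the
effects accumulated along a trace describe the current situation in terms of the initial one, and
the type decides each guard, context condition and termination condition
(`GologProgram.Represents.mem_iff`). Paths of the arena and executions therefore simulate each other
(`GologProgram.ArenaPath.execution`, `GologProgram.exists_arenaPath`).

Only finitely many effects arise: by acyclicity, regressing a descriptor of a fluent involves only
the effects on fluents of smaller depth, so the relevant effects, which are finitely many by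
construction, are closed under accumulation (`GologProgram.accumulate_subset_relEffects`).
Regression stays within two variables because the bound variable that substitution chooses avoids at
most one variable, whence it is `0` or `1` (`Fml.freshFor_mem`, `Fml.bv_subst_subset`).

For the temporal part, truth of formulas on finite traces is defined such that `xnf` is an
equivalence also at the last position (`TNF.holds_xnf`). The pair `(∅, ⊤)` reaches the obligations of
the last state iff one can choose locally true assignments along the trace such that each one meets
the next obligations of the one before. The actual truth values give such assignments if the
formula holds (`GologProgram.ArenaPath.isAccepting_of_holds`), and, conversely, truth propagates
backwards along such assignments (`GologProgram.ArenaPath.exists_holds_of_isAccepting`). The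
obligations do not depend on the chosen remaining programs, only on the trace.
-/

/-! ### Semantics of fluent formulas -/

namespace Fml
variable {S : Signature}

/-- Coincidence lemma: truth depends only on the fluents in the given situation and on the values of
the free variables. -/
theorem holds_congr {w w' : World S} {z z' : Trace S} (hw : ∀ F n, w F n z ↔ w' F n z')
    (φ : Fml S) {e e' : ℕ → S.Obj} (he : ∀ x ∈ φ.fv, e x = e' x) :
    Holds w z e φ ↔ Holds w' z' e' φ := by
  have tm : ∀ {e e' : ℕ → S.Obj} (t : Term S), (∀ x ∈ t.vars, e x = e' x) →
      t.eval e = t.eval e' := by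
    intro e e' t h
    cases t with
    | var x => exact h x (by simp [Term.vars])
    | name n => rfl
  have upd : ∀ {e e' : ℕ → S.Obj} {x : ℕ} {s : Finset ℕ}, (∀ y ∈ s.erase x, e y = e' y) →
      ∀ n, ∀ y ∈ s, Function.update e x n y = Function.update e' x n y := by
    intro e e' x s h n y hy
    by_cases hyx : y = x
    · simp [hyx]
    · simp [hyx, h y (Finset.mem_erase.2 ⟨hyx, hy⟩)]
  induction φ generalizing e e' with
  | top => simp [Holds]
  | eq s t =>
    simp only [fv, Finset.mem_union] at he
    simp only [Holds, tm s fun x hx => he x (.inl hx), tm t fun x hx => he x (.inr hx)]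
  | flu F v =>
    simp only [fv, Finset.mem_biUnion, Finset.mem_univ, true_and] at he
    simp only [Holds]
    rw [hw, funext fun i => tm (v i) fun x hx => he x ⟨i, hx⟩]
  | neg φ ih => simp only [Holds, ih he]
  | and φ ψ ih₁ ih₂ =>
    simp only [fv, Finset.mem_union] at he
    simp only [Holds, ih₁ fun x hx => he x (.inl hx), ih₂ fun x hx => he x (.inr hx)]
  | all x φ ih => simp only [Holds, fun n => ih (upd he n)]
  | atMost m x φ ih => simp only [Holds, fun n => ih (upd he n)]
  | atLeast m x φ ih => simp only [Holds, fun n => ih (upd he n)]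

theorem holds_congr_env {w : World S} {z : Trace S} {φ : Fml S} {e e' : ℕ → S.Obj}
    (he : ∀ x ∈ φ.fv, e x = e' x) : Holds w z e φ ↔ Holds w z e' φ :=
  holds_congr (fun _ _ => Iff.rfl) φ he

theorem holds_congr_world {w w' : World S} {z z' : Trace S} (hw : ∀ F n, w F n z ↔ w' F n z')
    (φ : Fml S) (e : ℕ → S.Obj) : Holds w z e φ ↔ Holds w' z' e φ :=
  holds_congr hw φ fun _ _ => rfl

theorem sat_iff_holds {w : World S} {z : Trace S} {φ : Fml S} (h : φ.fv = ∅) (e : ℕ → S.Obj) :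
    φ.Sat w z ↔ Holds w z e φ :=
  ⟨fun hs => hs e, fun hs e' => (holds_congr_env (by simp [h])).1 hs⟩

theorem sat_top {w : World S} {z : Trace S} : (top : Fml S).Sat w z := fun _ => trivial

theorem sat_neg {w : World S} {z : Trace S} {φ : Fml S} (h : φ.fv = ∅) :
    (neg φ).Sat w z ↔ ¬ φ.Sat w z := by
  obtain ⟨e⟩ : Nonempty (ℕ → S.Obj) := inferInstance
  rw [sat_iff_holds h e, sat_iff_holds (φ := neg φ) h e, Holds]

theorem sat_and {w : World S} {z : Trace S} {φ ψ : Fml S} :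
    (and φ ψ).Sat w z ↔ φ.Sat w z ∧ ψ.Sat w z := by
  simp only [Sat, Holds, forall_and]

theorem sat_or {w : World S} {z : Trace S} {φ ψ : Fml S} (h₁ : φ.fv = ∅) (h₂ : ψ.fv = ∅) :
    (or φ ψ).Sat w z ↔ φ.Sat w z ∨ ψ.Sat w z := by
  rw [or, sat_neg (by simp [fv, h₁, h₂]), sat_and, sat_neg h₁, sat_neg h₂]
  tauto

@[simp] theorem holds_or {w : World S} {z : Trace S} {e : ℕ → S.Obj} {φ ψ : Fml S} :
    Holds w z e (or φ ψ) ↔ Holds w z e φ ∨ Holds w z e ψ := by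
  simp only [or, Holds]; tauto

@[simp] theorem holds_bigAnd {w : World S} {z : Trace S} {e : ℕ → S.Obj} {s : Finset (Fml S)} :
    Holds w z e (bigAnd s) ↔ ∀ φ ∈ s, Holds w z e φ := by
  have : ∀ l : List (Fml S), Holds w z e (l.foldr and top) ↔ ∀ φ ∈ l, Holds w z e φ := by
    intro l
    induction l with
    | nil => simp [Holds]
    | cons a l ih => simp [Holds, ih]
  simp [bigAnd, this]

@[simp] theorem holds_bigOr {w : World S} {z : Trace S} {e : ℕ → S.Obj} {s : Finset (Fml S)} :
    Holds w z e (bigOr s) ↔ ∃ φ ∈ s, Holds w z e φ := by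
  have : ∀ l : List (Fml S), Holds w z e (l.foldr or bot) ↔ ∃ φ ∈ l, Holds w z e φ := by
    intro l
    induction l with
    | nil => simp [bot, Holds]
    | cons a l ih => simp [ih]
  simp [bigOr, this]

/-! ### Substitution -/

theorem freshFor_spec (σ : ℕ → Term S) (x : ℕ) (φ : Fml S) {y : ℕ} (hy : y ∈ φ.fv) (hyx : y ≠ x) :
    freshFor σ x φ ∉ (σ y).vars := by
  have hne : {j : ℕ | j ∉ (φ.fv.erase x).biUnion fun y => (σ y).vars}.Nonempty :=
    Infinite.exists_notMem_finset _
  have h : freshFor σ x φ ∉ (φ.fv.erase x).biUnion fun y => (σ y).vars := Nat.sInf_mem hne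
  intro hmem
  exact h (Finset.mem_biUnion.2 ⟨y, Finset.mem_erase.2 ⟨hyx, hy⟩, hmem⟩)

/-- If only one variable `j` could be captured, one of the variables `0` and `1` is fresh. -/
theorem freshFor_mem {σ : ℕ → Term S} {x : ℕ} {φ : Fml S} {j : ℕ}
    (h : ∀ y ∈ φ.fv, y ≠ x → (σ y).vars ⊆ {j}) : freshFor σ x φ ∈ ({0, 1} : Finset ℕ) := by
  have key : ∀ i, i ≠ j → freshFor σ x φ ≤ i := by
    intro i hi
    refine Nat.sInf_le ?_
    simp only [Set.mem_ofPred_eq, Finset.mem_biUnion, not_exists, not_and]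
    intro y hy hmem
    rw [Finset.mem_erase] at hy
    exact hi (by simpa using h y hy.2 hy.1 hmem)
  have : freshFor σ x φ ≤ 1 := by
    by_cases hj : j = 0
    · exact key 1 (by omega)
    · exact (key 0 (by omega)).trans zero_le_one
  simp only [Finset.mem_insert, Finset.mem_singleton]
  omega

theorem holds_subst {w : World S} {z : Trace S} (φ : Fml S) (σ : ℕ → Term S) (e : ℕ → S.Obj) :
    Holds w z e (subst σ φ) ↔ Holds w z (fun x => (σ x).eval e) φ := by
  have tm : ∀ (σ : ℕ → Term S) (e : ℕ → S.Obj) (t : Term S),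
      (subst.tm σ t).eval e = t.eval fun x => (σ x).eval e := by
    intro σ e t
    cases t <;> rfl
  have tmeq : ∀ {e e' : ℕ → S.Obj} (t : Term S), (∀ x ∈ t.vars, e x = e' x) →
      t.eval e = t.eval e' := by
    intro e e' t h
    cases t with
    | var x => exact h x (by simp [Term.vars])
    | name n => rfl
  have upd : ∀ (φ : Fml S) (σ : ℕ → Term S) (e : ℕ → S.Obj) (x : ℕ) (n : S.Obj),
      Holds w z (fun y => (Function.update σ x (.var (freshFor σ x φ)) y).eval
        (Function.update e (freshFor σ x φ) n)) φ ↔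
      Holds w z (Function.update (fun y => (σ y).eval e) x n) φ := by
    intro φ σ e x n
    refine holds_congr_env fun y hy => ?_
    by_cases hyx : y = x
    · subst hyx
      simp [Term.eval]
    · simp only [Function.update_of_ne hyx]
      refine tmeq _ fun v hv => ?_
      rw [Function.update_of_ne]
      rintro rfl
      exact freshFor_spec σ x φ hy hyx hv
  induction φ generalizing σ e with
  | top => simp [subst, Holds]
  | eq s t => simp only [subst, Holds, tm]
  | flu F v => simp only [subst, Holds, tm]
  | neg φ ih => simp only [subst, Holds, ih]
  | and φ ψ ih₁ ih₂ => simp only [subst, Holds, ih₁, ih₂]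
  | all x φ ih => simp only [subst, Holds, ih, upd]
  | atMost m x φ ih => simp only [subst, Holds, ih, upd]
  | atLeast m x φ ih => simp only [subst, Holds, ih, upd]

theorem exists_mem_fv_of_mem_subst (φ : Fml S) (σ : ℕ → Term S) {j : ℕ} (hj : j ∈ (subst σ φ).fv) :
    ∃ y ∈ φ.fv, j ∈ (σ y).vars := by
  have tm : ∀ (σ : ℕ → Term S) (t : Term S), j ∈ (subst.tm σ t).vars →
      ∃ y ∈ t.vars, j ∈ (σ y).vars := by
    intro σ t h
    cases t with
    | var x => exact ⟨x, by simp [Term.vars], h⟩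
    | name n => simp [subst.tm, Term.vars] at h
  have upd : ∀ (φ : Fml S) (σ : ℕ → Term S) (x : ℕ), j ≠ freshFor σ x φ →
      (∃ y ∈ φ.fv, j ∈ (Function.update σ x (.var (freshFor σ x φ)) y).vars) →
      ∃ y ∈ φ.fv.erase x, j ∈ (σ y).vars := by
    rintro φ σ x hne ⟨y, hy, h⟩
    by_cases hyx : y = x
    · subst hyx
      simp [Term.vars, hne] at h
    · rw [Function.update_of_ne hyx] at h
      exact ⟨y, Finset.mem_erase.2 ⟨hyx, hy⟩, h⟩
  induction φ generalizing σ with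
  | top => simp [subst, fv] at hj
  | eq s t =>
    simp only [subst, fv, Finset.mem_union] at hj ⊢
    rcases hj with h | h
    · obtain ⟨y, hy, h⟩ := tm _ _ h
      exact ⟨y, .inl hy, h⟩
    · obtain ⟨y, hy, h⟩ := tm _ _ h
      exact ⟨y, .inr hy, h⟩
  | flu F v =>
    simp only [subst, fv, Finset.mem_biUnion, Finset.mem_univ, true_and] at hj ⊢
    obtain ⟨i, h⟩ := hj
    obtain ⟨y, hy, h⟩ := tm _ _ h
    exact ⟨y, ⟨i, hy⟩, h⟩
  | neg φ ih => exact ih σ hj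
  | and φ ψ ih₁ ih₂ =>
    simp only [subst, fv, Finset.mem_union] at hj ⊢
    rcases hj with h | h
    · obtain ⟨y, hy, h⟩ := ih₁ _ h
      exact ⟨y, .inl hy, h⟩
    · obtain ⟨y, hy, h⟩ := ih₂ _ h
      exact ⟨y, .inr hy, h⟩
  | all x φ ih =>
    simp only [subst, fv, Finset.mem_erase] at hj
    exact upd φ σ x hj.1 (ih _ hj.2)
  | atMost m x φ ih =>
    simp only [subst, fv, Finset.mem_erase] at hj
    exact upd φ σ x hj.1 (ih _ hj.2)
  | atLeast m x φ ih =>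
    simp only [subst, fv, Finset.mem_erase] at hj
    exact upd φ σ x hj.1 (ih _ hj.2)

/-- Substitution needs only the bound variables `0` and `1` if at most two variables of the formula
are bound or replaced by terms that are not names: below a quantifier over one of them, at most one
variable could be captured. -/
theorem bv_subst_subset (φ : Fml S) (σ : ℕ → Term S) (B : Finset ℕ) (hB : B.card ≤ 2)
    (hbv : φ.bv ⊆ B) (hσ : ∀ y ∈ φ.fv, y ∉ B → (σ y).vars = ∅) :
    (subst σ φ).bv ⊆ {0, 1} := by
  have sub1 : ∀ t : Term S, ∃ j, t.vars ⊆ {j} := by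
    rintro (x | n)
    · exact ⟨x, by simp [Term.vars]⟩
    · exact ⟨0, by simp [Term.vars]⟩
  have fresh : ∀ (φ : Fml S) (σ : ℕ → Term S) (x : ℕ), x ∈ B →
      (∀ y ∈ φ.fv.erase x, y ∉ B → (σ y).vars = ∅) →
      freshFor σ x φ ∈ ({0, 1} : Finset ℕ) := by
    intro φ σ x hx h
    have hc : (B.erase x).card ≤ 1 := by
      rw [Finset.card_erase_of_mem hx]; omega
    obtain ⟨b, hb⟩ := Finset.card_le_one_iff_subset_singleton.1 hc
    obtain ⟨j, hj⟩ := sub1 (σ b)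
    refine freshFor_mem (j := j) fun y hy hyx => ?_
    by_cases hyB : y ∈ B
    · have : y = b := by simpa using hb (Finset.mem_erase.2 ⟨hyx, hyB⟩)
      exact this ▸ hj
    · simp [h y (Finset.mem_erase.2 ⟨hyx, hy⟩) hyB]
  have upd : ∀ (φ : Fml S) (σ : ℕ → Term S) (x j : ℕ), x ∈ B →
      (∀ y ∈ φ.fv.erase x, y ∉ B → (σ y).vars = ∅) →
      ∀ y ∈ φ.fv, y ∉ B → (Function.update σ x (.var j) y).vars = ∅ := by
    intro φ σ x j hx h y hy hyB
    have hyx : y ≠ x := fun h => hyB (h ▸ hx)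
    rw [Function.update_of_ne hyx]
    exact h y (Finset.mem_erase.2 ⟨hyx, hy⟩) hyB
  induction φ generalizing σ with
  | top => simp [subst, bv]
  | eq s t => simp [subst, bv]
  | flu F v => simp [subst, bv]
  | neg φ ih => exact ih σ hbv hσ
  | and φ ψ ih₁ ih₂ =>
    simp only [bv, fv, Finset.mem_union] at hbv hσ
    exact Finset.union_subset
      (ih₁ σ (Finset.subset_union_left.trans hbv) fun y hy => hσ y (.inl hy))
      (ih₂ σ (Finset.subset_union_right.trans hbv) fun y hy => hσ y (.inr hy))
  | all x φ ih =>
    obtain ⟨hx, hb⟩ := Finset.insert_subset_iff.1 hbv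
    exact Finset.insert_subset (fresh φ σ x hx hσ) (ih _ hb (upd φ σ x _ hx hσ))
  | atMost m x φ ih =>
    obtain ⟨hx, hb⟩ := Finset.insert_subset_iff.1 hbv
    exact Finset.insert_subset (fresh φ σ x hx hσ) (ih _ hb (upd φ σ x _ hx hσ))
  | atLeast m x φ ih =>
    obtain ⟨hx, hb⟩ := Finset.insert_subset_iff.1 hbv
    exact Finset.insert_subset (fresh φ σ x hx hσ) (ih _ hb (upd φ σ x _ hx hσ))

theorem fluents_subst (φ : Fml S) (σ : ℕ → Term S) : (subst σ φ).fluents = φ.fluents := by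
  induction φ generalizing σ with
  | top => rfl
  | eq s t => rfl
  | flu F v => rfl
  | neg φ ih => exact ih σ
  | and φ ψ ih₁ ih₂ => simp only [subst, fluents, ih₁, ih₂]
  | all x φ ih => exact ih _
  | atMost m x φ ih => exact ih _
  | atLeast m x φ ih => exact ih _

/-! ### Formulas with two variables -/

/-- Formulas whose free variables are among the first `k` and that use only the variables `0` and
`1`: the descriptors of effects on a fluent of arity `k ≤ 2`, and C²-sentences for `k = 0`. -/
def IsDescr (k : ℕ) (φ : Fml S) : Prop := φ.fv ⊆ Finset.range k ∧ φ.bv ⊆ {0, 1}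

theorem range_subset_pair {k : ℕ} (hk : k ≤ 2) : Finset.range k ⊆ {0, 1} := by
  intro x hx
  simp only [Finset.mem_range, Finset.mem_insert, Finset.mem_singleton] at *
  omega

theorem isC2Sentence_iff {φ : Fml S} : φ.IsC2Sentence ↔ φ.fv = ∅ ∧ φ.bv ⊆ {0, 1} := by
  constructor
  · rintro ⟨h, h'⟩
    exact ⟨h, Finset.subset_union_right.trans h'⟩
  · rintro ⟨h, h'⟩
    exact ⟨h, by simpa [vars, h] using h'⟩

theorem isC2Sentence_top : (top : Fml S).IsC2Sentence := by simp [IsC2Sentence, vars, fv, bv]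

theorem IsC2Sentence.neg {φ : Fml S} (h : φ.IsC2Sentence) : (neg φ).IsC2Sentence := h

theorem IsC2Sentence.and {φ ψ : Fml S} (h₁ : φ.IsC2Sentence) (h₂ : ψ.IsC2Sentence) :
    (and φ ψ).IsC2Sentence := by
  rw [isC2Sentence_iff] at *
  exact ⟨by simp [fv, h₁.1, h₂.1], Finset.union_subset h₁.2 h₂.2⟩

theorem IsC2Sentence.or {φ ψ : Fml S} (h₁ : φ.IsC2Sentence) (h₂ : ψ.IsC2Sentence) :
    (or φ ψ).IsC2Sentence := (h₁.neg.and h₂.neg).neg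

theorem exists_mem_fv_bigAnd {s : Finset (Fml S)} {x : ℕ} (h : x ∈ (bigAnd s).fv) :
    ∃ φ ∈ s, x ∈ φ.fv := by
  have : ∀ l : List (Fml S), x ∈ (l.foldr and top).fv → ∃ φ ∈ l, x ∈ φ.fv := by
    intro l
    induction l with
    | nil => simp [fv]
    | cons a l ih => simp only [List.foldr, fv, Finset.mem_union, List.mem_cons]; grind
  simpa using this _ h

theorem exists_mem_bv_bigAnd {s : Finset (Fml S)} {x : ℕ} (h : x ∈ (bigAnd s).bv) :
    ∃ φ ∈ s, x ∈ φ.bv := by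
  have : ∀ l : List (Fml S), x ∈ (l.foldr and top).bv → ∃ φ ∈ l, x ∈ φ.bv := by
    intro l
    induction l with
    | nil => simp [bv]
    | cons a l ih => simp only [List.foldr, bv, Finset.mem_union, List.mem_cons]; grind
  simpa using this _ h

theorem exists_mem_fv_bigOr {s : Finset (Fml S)} {x : ℕ} (h : x ∈ (bigOr s).fv) :
    ∃ φ ∈ s, x ∈ φ.fv := by
  have : ∀ l : List (Fml S), x ∈ (l.foldr or bot).fv → ∃ φ ∈ l, x ∈ φ.fv := by
    intro l
    induction l with
    | nil => simp [bot, fv]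
    | cons a l ih => simp only [List.foldr, or, fv, Finset.mem_union, List.mem_cons]; grind
  simpa using this _ h

theorem exists_mem_bv_bigOr {s : Finset (Fml S)} {x : ℕ} (h : x ∈ (bigOr s).bv) :
    ∃ φ ∈ s, x ∈ φ.bv := by
  have : ∀ l : List (Fml S), x ∈ (l.foldr or bot).bv → ∃ φ ∈ l, x ∈ φ.bv := by
    intro l
    induction l with
    | nil => simp [bot, bv]
    | cons a l ih => simp only [List.foldr, or, bv, Finset.mem_union, List.mem_cons]; grind
  simpa using this _ h

end Fml

/-! ### Effects, regression and accumulation -/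

section Effects
open Classical
variable {S : Signature}

theorem mem_delDescr {E : Finset (Effect S)} {F : S.Flu} {ε : Fml S} :
    ε ∈ delDescr E F ↔ Effect.del F ε ∈ E := by
  simp only [delDescr, Finset.mem_biUnion]
  constructor
  · rintro ⟨_ | ⟨F', φ⟩, he, h⟩
    · simp at h
    · grind
  · intro h
    exact ⟨_, h, by simp⟩

theorem mem_addDescr {E : Finset (Effect S)} {F : S.Flu} {ψ : Fml S} :
    ψ ∈ addDescr E F ↔
      ∃ φ N, Effect.add F φ N ∈ E ∧ ψ = .and φ (.bigAnd (N.image .neg)) := by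
  simp only [addDescr, Finset.mem_biUnion]
  constructor
  · rintro ⟨⟨F', φ, N⟩ | _, he, h⟩
    · by_cases hF : F' = F
      · subst hF
        exact ⟨φ, N, he, by simpa using h⟩
      · simp [hF] at h
    · simp at h
  · rintro ⟨φ, N, h, rfl⟩
    exact ⟨_, h, by simp⟩

/-- The fluent that an effect is about. -/
def Effect.fluent : Effect S → S.Flu
  | .add F _ _ => F
  | .del F _ => F

/-- Effects whose descriptors are two-variable formulas about the arguments of the fluent. -/
def Effect.IsWF : Effect S → Prop
  | .add F φ N => φ.IsDescr (S.fluArity F) ∧ ∀ ν ∈ N, ν.IsDescr (S.fluArity F)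
  | .del F φ => φ.IsDescr (S.fluArity F)

theorem isDescr_delDescr {E : Finset (Effect S)} (hE : ∀ e ∈ E, e.IsWF) {F : S.Flu} {ε : Fml S}
    (h : ε ∈ delDescr E F) : ε.IsDescr (S.fluArity F) :=
  hE _ (mem_delDescr.1 h)

theorem isDescr_addDescr {E : Finset (Effect S)} (hE : ∀ e ∈ E, e.IsWF) {F : S.Flu} {ε : Fml S}
    (h : ε ∈ addDescr E F) : ε.IsDescr (S.fluArity F) := by
  obtain ⟨φ, N, he, rfl⟩ := mem_addDescr.1 h
  obtain ⟨h₁, h₂⟩ := hE _ he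
  constructor
  · refine Finset.union_subset h₁.1 fun x hx => ?_
    obtain ⟨ψ, hψ, hx⟩ := Fml.exists_mem_fv_bigAnd hx
    obtain ⟨ν, hν, rfl⟩ := Finset.mem_image.1 hψ
    exact (h₂ ν hν).1 hx
  · refine Finset.union_subset h₁.2 fun x hx => ?_
    obtain ⟨ψ, hψ, hx⟩ := Fml.exists_mem_bv_bigAnd hx
    obtain ⟨ν, hν, rfl⟩ := Finset.mem_image.1 hψ
    exact (h₂ ν hν).2 hx

theorem fv_substArgs_subset {k : ℕ} (v : Fin k → Term S) {φ : Fml S} (h : φ.fv ⊆ Finset.range k) :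
    (substArgs v φ).fv ⊆ Finset.univ.biUnion fun i => (v i).vars := by
  intro j hj
  obtain ⟨y, hy, hj⟩ := Fml.exists_mem_fv_of_mem_subst φ _ hj
  have hyk := Finset.mem_range.1 (h hy)
  rw [dif_pos hyk] at hj
  exact Finset.mem_biUnion.2 ⟨⟨y, hyk⟩, Finset.mem_univ _, hj⟩

theorem bv_substArgs_subset {k : ℕ} (hk : k ≤ 2) (v : Fin k → Term S) {φ : Fml S}
    (h : φ.IsDescr k) : (substArgs v φ).bv ⊆ {0, 1} := by
  refine Fml.bv_subst_subset φ _ {0, 1} (by simp) h.2 fun y hy hyB => ?_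
  exact absurd (Fml.range_subset_pair hk (h.1 hy)) hyB

theorem fv_regress_subset {E : Finset (Effect S)} (hE : ∀ e ∈ E, e.IsWF) (φ : Fml S) :
    (regress E φ).fv ⊆ φ.fv := by
  induction φ with
  | top => simp [regress]
  | eq s t => simp [regress]
  | flu F v =>
    intro x hx
    simp only [regress, Fml.or, Fml.fv, Finset.mem_union] at hx
    rcases hx with (hx | hx) | hx
    · exact hx
    · obtain ⟨ψ, hψ, hx⟩ := Fml.exists_mem_fv_bigAnd hx
      obtain ⟨ε, hε, rfl⟩ := Finset.mem_image.1 hψ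
      exact fv_substArgs_subset v (isDescr_delDescr hE hε).1 hx
    · obtain ⟨ψ, hψ, hx⟩ := Fml.exists_mem_fv_bigOr hx
      obtain ⟨ε, hε, rfl⟩ := Finset.mem_image.1 hψ
      exact fv_substArgs_subset v (isDescr_addDescr hE hε).1 hx
  | neg φ ih => exact ih
  | and φ ψ ih₁ ih₂ => exact Finset.union_subset_union ih₁ ih₂
  | all x φ ih => exact Finset.erase_subset_erase _ ih
  | atMost m x φ ih => exact Finset.erase_subset_erase _ ih
  | atLeast m x φ ih => exact Finset.erase_subset_erase _ ih

theorem bv_regress_subset {E : Finset (Effect S)} (hE : ∀ e ∈ E, e.IsWF) {φ : Fml S}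
    (hφ : φ.bv ⊆ {0, 1}) : (regress E φ).bv ⊆ {0, 1} := by
  induction φ with
  | top => simp [regress, Fml.bv]
  | eq s t => simp [regress, Fml.bv]
  | flu F v =>
    intro x hx
    simp only [regress, Fml.or, Fml.bv, Finset.mem_union] at hx
    rcases hx with (hx | hx) | hx
    · simp at hx
    · obtain ⟨ψ, hψ, hx⟩ := Fml.exists_mem_bv_bigAnd hx
      obtain ⟨ε, hε, rfl⟩ := Finset.mem_image.1 hψ
      exact bv_substArgs_subset (S.fluArity_le F) v (isDescr_delDescr hE hε) hx
    · obtain ⟨ψ, hψ, hx⟩ := Fml.exists_mem_bv_bigOr hx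
      obtain ⟨ε, hε, rfl⟩ := Finset.mem_image.1 hψ
      exact bv_substArgs_subset (S.fluArity_le F) v (isDescr_addDescr hE hε) hx
  | neg φ ih => exact ih hφ
  | and φ ψ ih₁ ih₂ =>
    exact Finset.union_subset (ih₁ (Finset.subset_union_left.trans hφ))
      (ih₂ (Finset.subset_union_right.trans hφ))
  | all x φ ih =>
    obtain ⟨hx, hb⟩ := Finset.insert_subset_iff.1 hφ
    exact Finset.insert_subset hx (ih hb)
  | atMost m x φ ih =>
    obtain ⟨hx, hb⟩ := Finset.insert_subset_iff.1 hφ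
    exact Finset.insert_subset hx (ih hb)
  | atLeast m x φ ih =>
    obtain ⟨hx, hb⟩ := Finset.insert_subset_iff.1 hφ
    exact Finset.insert_subset hx (ih hb)

theorem Fml.IsDescr.regress {E : Finset (Effect S)} (hE : ∀ e ∈ E, e.IsWF) {k : ℕ} {φ : Fml S}
    (h : φ.IsDescr k) : (regress E φ).IsDescr k :=
  ⟨(fv_regress_subset hE φ).trans h.1, bv_regress_subset hE h.2⟩

theorem Fml.IsC2Sentence.regress {E : Finset (Effect S)} (hE : ∀ e ∈ E, e.IsWF) {φ : Fml S}
    (h : φ.IsC2Sentence) : (regress E φ).IsC2Sentence := by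
  rw [Fml.isC2Sentence_iff] at *
  exact ⟨Finset.subset_empty.1 (h.1 ▸ fv_regress_subset hE φ), bv_regress_subset hE h.2⟩

/-- Regression looks only at the effects on the fluents of the formula. -/
theorem regress_congr {E E' : Finset (Effect S)} (φ : Fml S)
    (h : ∀ F ∈ φ.fluents, delDescr E F = delDescr E' F ∧ addDescr E F = addDescr E' F) :
    regress E φ = regress E' φ := by
  induction φ with
  | top => rfl
  | eq s t => rfl
  | flu F v => simp only [regress, (h F rfl).1, (h F rfl).2]
  | neg φ ih => simp only [regress, ih h]
  | and φ ψ ih₁ ih₂ =>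
    simp only [regress, ih₁ fun F hF => h F (.inl hF), ih₂ fun F hF => h F (.inr hF)]
  | all x φ ih => simp only [regress, ih h]
  | atMost m x φ ih => simp only [regress, ih h]
  | atLeast m x φ ih => simp only [regress, ih h]

theorem regress_filter (E : Finset (Effect S)) (φ : Fml S) (p : S.Flu → Prop)
    [DecidablePred p] (h : ∀ F ∈ φ.fluents, p F) :
    regress (E.filter fun e => p e.fluent) φ = regress E φ := by
  refine regress_congr φ fun F hF => ⟨?_, ?_⟩
  · ext ε
    simp [mem_delDescr, show p (Effect.del F ε).fluent from h F hF]
  · ext ε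
    have hp : ∀ φ N, p (Effect.add F φ N).fluent := fun _ _ => h F hF
    simp [mem_addDescr, hp]

/-- The variable assignment that gives the formal arguments `0, …, k - 1` the values `n`. -/
noncomputable def argEnv {k : ℕ} (n : Fin k → S.Obj) : ℕ → S.Obj :=
  fun x => if h : x < k then n ⟨x, h⟩ else Classical.arbitrary S.Obj

theorem argEnv_apply {k : ℕ} (n : Fin k → S.Obj) (i : Fin k) : argEnv n i = n i := by
  simp [argEnv]

/-- The world in which, in each situation, the effects `E` have taken place simultaneously. It
interprets formulas in the way regression through `E` does. -/
noncomputable def applyEffects (E : Finset (Effect S)) (w : World S) : World S := fun F n z =>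
  (w F n z ∧ ∀ ε ∈ delDescr E F, ¬ ε.Holds w z (argEnv n)) ∨
    ∃ ε ∈ addDescr E F, ε.Holds w z (argEnv n)

theorem holds_substArgs {w : World S} {z : Trace S} {e : ℕ → S.Obj} {k : ℕ} (v : Fin k → Term S)
    {φ : Fml S} (h : φ.fv ⊆ Finset.range k) :
    (substArgs v φ).Holds w z e ↔ φ.Holds w z (argEnv fun i => (v i).eval e) := by
  rw [substArgs, Fml.holds_subst]
  refine Fml.holds_congr_env fun x hx => ?_
  have hxk := Finset.mem_range.1 (h hx)
  simp [argEnv, hxk]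

/-- Regression through `E` evaluates the formula after the effects `E`. -/
theorem holds_regress {E : Finset (Effect S)} (hE : ∀ e ∈ E, e.IsWF) {w : World S} {z : Trace S}
    (φ : Fml S) (e : ℕ → S.Obj) :
    (regress E φ).Holds w z e ↔ φ.Holds (applyEffects E w) z e := by
  induction φ generalizing e with
  | top => simp [regress, Fml.Holds]
  | eq s t => simp [regress, Fml.Holds]
  | flu F v =>
    simp only [regress, Fml.holds_or, Fml.Holds, Fml.holds_bigAnd, Fml.holds_bigOr,
      Finset.forall_mem_image, Finset.exists_mem_image, applyEffects]
    refine or_congr (and_congr_right fun _ => forall₂_congr fun ε hε => not_congr ?_)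
      (exists_congr fun ε => and_congr_right fun hε => ?_)
    · exact holds_substArgs v (isDescr_delDescr hE hε).1
    · exact holds_substArgs v (isDescr_addDescr hE hε).1
  | neg φ ih => simp only [regress, Fml.Holds, ih]
  | and φ ψ ih₁ ih₂ => simp only [regress, Fml.Holds, ih₁, ih₂]
  | all x φ ih => simp only [regress, Fml.Holds, ih]
  | atMost m x φ ih => simp only [regress, Fml.Holds, ih]
  | atLeast m x φ ih => simp only [regress, Fml.Holds, ih]

/-- The value of a fluent after effects, with the composite descriptors taken apart. -/
theorem applyEffects_iff {E : Finset (Effect S)} {w : World S} {F : S.Flu}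
    {n : Fin (S.fluArity F) → S.Obj} {z : Trace S} :
    applyEffects E w F n z ↔
      (w F n z ∧ ∀ ε, Effect.del F ε ∈ E → ¬ ε.Holds w z (argEnv n)) ∨
      ∃ φ N, Effect.add F φ N ∈ E ∧ φ.Holds w z (argEnv n) ∧
        ∀ ν ∈ N, ¬ ν.Holds w z (argEnv n) := by
  simp only [applyEffects, mem_delDescr, mem_addDescr]
  refine or_congr Iff.rfl ⟨?_, ?_⟩
  · rintro ⟨_, ⟨φ, N, h, rfl⟩, h'⟩
    simp only [Fml.Holds, Fml.holds_bigAnd, Finset.forall_mem_image] at h'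
    exact ⟨φ, N, h, h'.1, fun ν hν => h'.2 hν⟩
  · rintro ⟨φ, N, h, h₁, h₂⟩
    refine ⟨_, ⟨φ, N, h, rfl⟩, ?_⟩
    simp only [Fml.Holds, Fml.holds_bigAnd, Finset.forall_mem_image]
    exact ⟨h₁, fun ν hν => h₂ ν hν⟩

theorem del_mem_accumulate {E₀ E₁ : Finset (Effect S)} {F : S.Flu} {ε : Fml S} :
    Effect.del F ε ∈ accumulate E₀ E₁ ↔
      (∃ φ, Effect.del F φ ∈ E₁ ∧ ε = regress E₀ φ) ∨ Effect.del F ε ∈ E₀ := by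
  simp only [accumulate, Finset.mem_union, Finset.mem_image]
  refine or_congr ⟨?_, ?_⟩ ⟨?_, ?_⟩
  · rintro ⟨_ | ⟨F', φ⟩, he, h⟩
    · simp at h
    · obtain ⟨rfl, rfl⟩ := Effect.del.inj h
      exact ⟨φ, he, rfl⟩
  · rintro ⟨φ, h, rfl⟩
    exact ⟨_, h, rfl⟩
  · rintro ⟨_ | ⟨F', φ⟩, he, h⟩
    · simp at h
    · obtain ⟨rfl, rfl⟩ := Effect.del.inj h
      exact he
  · intro h
    exact ⟨_, h, rfl⟩

theorem add_mem_accumulate {E₀ E₁ : Finset (Effect S)} {F : S.Flu} {ψ : Fml S}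
    {M : Finset (Fml S)} :
    Effect.add F ψ M ∈ accumulate E₀ E₁ ↔
      (∃ φ N, Effect.add F φ N ∈ E₁ ∧ ψ = regress E₀ φ ∧ M = N.image (regress E₀)) ∨
      ∃ N, Effect.add F ψ N ∈ E₀ ∧ M = N ∪ (delDescr E₁ F).image (regress E₀) := by
  simp only [accumulate, Finset.mem_union, Finset.mem_image]
  refine or_congr ⟨?_, ?_⟩ ⟨?_, ?_⟩
  · rintro ⟨⟨F', φ, N⟩ | _, he, h⟩
    · obtain ⟨rfl, rfl, rfl⟩ := Effect.add.inj h
      exact ⟨φ, N, he, rfl, rfl⟩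
    · simp at h
  · rintro ⟨φ, N, h, rfl, rfl⟩
    exact ⟨_, h, rfl⟩
  · rintro ⟨⟨F', φ, N⟩ | _, he, h⟩
    · obtain ⟨rfl, rfl, rfl⟩ := Effect.add.inj h
      exact ⟨N, he, rfl⟩
    · simp at h
  · rintro ⟨N, h, rfl⟩
    exact ⟨_, h, rfl⟩

/-- Accumulation composes effects. -/
theorem applyEffects_accumulate {E₀ : Finset (Effect S)} (hE : ∀ e ∈ E₀, e.IsWF)
    (E₁ : Finset (Effect S)) (w : World S) (F : S.Flu) (n : Fin (S.fluArity F) → S.Obj)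
    (z : Trace S) :
    applyEffects (accumulate E₀ E₁) w F n z ↔ applyEffects E₁ (applyEffects E₀ w) F n z := by
  rw [applyEffects_iff, applyEffects_iff (E := E₁), applyEffects_iff (E := E₀)]
  simp only [del_mem_accumulate, add_mem_accumulate, ← holds_regress hE]
  constructor
  · rintro (⟨h, hd⟩ | ⟨ψ, M, (⟨φ, N, he, rfl, rfl⟩ | ⟨N, he, rfl⟩), h, hM⟩)
    · exact .inl ⟨.inl ⟨h, fun ε hε => hd ε (.inr hε)⟩, fun ε hε => hd _ (.inl ⟨ε, hε, rfl⟩)⟩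
    · exact .inr ⟨φ, N, he, h, fun ν hν => hM _ (Finset.mem_image_of_mem _ hν)⟩
    -- An earlier positive effect survives as a true fluent that no later effect deletes.
    · refine .inl ⟨.inr ⟨ψ, N, he, h, fun ν hν => hM ν (Finset.mem_union_left _ hν)⟩, ?_⟩
      intro ε hε
      exact hM _ (Finset.mem_union_right _ (Finset.mem_image_of_mem _ (mem_delDescr.2 hε)))
  · rintro (⟨⟨h, hd⟩ | ⟨φ, N, he, h, hN⟩, hd'⟩ | ⟨φ, N, he, h, hN⟩)
    · refine .inl ⟨h, ?_⟩
      rintro ε (⟨φ, hφ, rfl⟩ | hε)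
      · exact hd' φ hφ
      · exact hd ε hε
    · refine .inr ⟨φ, _, .inr ⟨N, he, rfl⟩, h, fun ν hν => ?_⟩
      rcases Finset.mem_union.1 hν with hν | hν
      · exact hN ν hν
      · obtain ⟨ε, hε, rfl⟩ := Finset.mem_image.1 hν
        exact hd' ε (mem_delDescr.1 hε)
    · refine .inr ⟨_, _, .inl ⟨φ, N, he, rfl, rfl⟩, h, ?_⟩
      simpa only [Finset.forall_mem_image] using fun ν hν => hN ν hν

theorem applyEffects_empty (w : World S) (F : S.Flu) (n : Fin (S.fluArity F) → S.Obj)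
    (z : Trace S) : applyEffects ∅ w F n z ↔ w F n z := by
  simp [applyEffects_iff]

end Effects

/-! ### Instantiated effect conditions -/

namespace Disjunct
variable {S : Signature} {k : ℕ} (d : Disjunct S k)

theorem action_eq_iff {e e' : ℕ → S.Obj} :
    d.action e = d.action e' ↔ ∀ x ∈ d.argVars, e x = e' x := by
  have h : d.action e = d.action e' ↔ ∀ j, (d.args j).eval e = (d.args j).eval e' := by
    simp only [action, GroundAction.mk.injEq, heq_eq_eq, true_and, funext_iff]
  rw [h]
  simp only [argVars, Finset.mem_biUnion, Finset.mem_univ, true_and, forall_exists_index]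
  constructor
  · intro h x j hx
    have := h j
    generalize d.args j = t at this hx
    cases t with
    | var y =>
      obtain rfl : x = y := by simpa [Term.vars] using hx
      exact this
    | name n => simp [Term.vars] at hx
  · intro h j
    have := fun x => h x j
    generalize d.args j = t at this
    cases t with
    | var y => exact this y (by simp [Term.vars])
    | name n => rfl

/-- The substitution that grounds a disjunct by the action that it denotes under `e`. -/
def groundSubst (e : ℕ → S.Obj) : ℕ → Term S :=
  fun x => if x ∈ d.argVars then .name (e x) else .var x

/-- The effect descriptor of a disjunct, grounded by the action that it denotes under `e`. -/
noncomputable def groundEff (e : ℕ → S.Obj) : Fml S :=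
  ((List.range k).filter (· ∈ d.argVars)).foldr
    (fun x φ => .and (.eq (.var x) (.name (e x))) φ) (d.eff.subst (d.groundSubst e))

theorem ground_eq_some {α : GroundAction S} {p : Fml S × Fml S} (h : d.ground α = some p) :
    ∃ e, α = d.action e ∧ p = (d.groundEff e, d.ctx.subst (d.groundSubst e)) := by
  unfold ground at h
  split_ifs at h with hα
  exact ⟨_, hα.choose_spec, (Option.some.inj h).symm⟩

theorem exists_ground_eq_some {α : GroundAction S} (h : ∃ e, α = d.action e) :
    ∃ p, d.ground α = some p := by
  unfold ground
  rw [dif_pos h]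
  exact ⟨_, rfl⟩

theorem holds_groundEff {w : World S} {z : Trace S} (e₀ e : ℕ → S.Obj) :
    (d.groundEff e₀).Holds w z e ↔ (∀ x < k, x ∈ d.argVars → e x = e₀ x) ∧
      d.eff.Holds w z fun x => if x ∈ d.argVars then e₀ x else e x := by
  have hfold : ∀ (l : List ℕ) (ψ : Fml S),
      (l.foldr (fun x φ => Fml.and (.eq (.var x) (.name (e₀ x))) φ) ψ).Holds w z e ↔
        (∀ x ∈ l, e x = e₀ x) ∧ ψ.Holds w z e := by
    intro l ψ
    induction l with
    | nil => simp
    | cons a l ih => simp [Fml.Holds, ih, Term.eval, and_assoc]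
  rw [groundEff, hfold, Fml.holds_subst]
  refine and_congr (by simp) (Fml.holds_congr_env fun x _ => ?_)
  by_cases hx : x ∈ d.argVars <;> simp [groundSubst, hx, Term.eval]

theorem holds_groundCtx {w : World S} {z : Trace S} (e₀ e : ℕ → S.Obj) :
    (d.ctx.subst (d.groundSubst e₀)).Holds w z e ↔ d.ctx.Holds w z e₀ := by
  rw [Fml.holds_subst]
  refine Fml.holds_congr_env fun x hx => ?_
  have hx : x ∈ d.argVars := d.ctx_fv hx
  simp [groundSubst, hx, Term.eval]

/-- Instantiating a disjunct by an action preserves its truth for that action. -/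
theorem holds_iff_ground {w : World S} {z : Trace S} {α : GroundAction S} {n : Fin k → S.Obj} :
    d.Holds w z α n ↔ ∃ p, d.ground α = some p ∧ p.1.Holds w z (argEnv n) ∧
      p.2.Holds w z (argEnv n) := by
  constructor
  · rintro ⟨e, hn, hα, heff, hctx⟩
    obtain ⟨p, hp⟩ := d.exists_ground_eq_some ⟨e, hα⟩
    refine ⟨p, hp, ?_⟩
    obtain ⟨e₀, hα', rfl⟩ := d.ground_eq_some hp
    have hee := d.action_eq_iff.1 (hα.symm.trans hα')
    simp only [holds_groundEff, holds_groundCtx]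
    refine ⟨⟨fun x hx hxa => ?_, ?_⟩, ?_⟩
    · rw [← hee x hxa, ← argEnv_apply n ⟨x, hx⟩ |>.trans (hn ⟨x, hx⟩).symm]
    · refine (Fml.holds_congr_env fun x hx => ?_).1 heff
      by_cases hxa : x ∈ d.argVars
      · simp [hxa, hee x hxa]
      · rcases Finset.mem_union.1 (d.eff_fv hx) with hxk | h
        · have := Finset.mem_range.1 hxk
          simp [hxa, argEnv, this, ← hn]
        · exact absurd h hxa
    · exact (Fml.holds_congr_env fun x hx => hee x (d.ctx_fv hx)).1 hctx
  · rintro ⟨p, hp, heff, hctx⟩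
    obtain ⟨e₀, hα, rfl⟩ := d.ground_eq_some hp
    simp only [holds_groundEff, holds_groundCtx] at heff hctx
    -- The equations kept in the descriptor make this assignment extend `n`.
    refine ⟨fun x => if x ∈ d.argVars then e₀ x else argEnv n x, fun i => ?_, ?_, heff.2, ?_⟩
    · by_cases hi : (i : ℕ) ∈ d.argVars
      · simp only [hi, if_true, ← heff.1 i i.2 hi, argEnv_apply]
      · simp only [hi, if_false, argEnv_apply]
    · rw [hα, action_eq_iff]
      intro x hx
      simp [hx]
    · refine (Fml.holds_congr_env fun x hx => ?_).1 hctx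
      have hx : x ∈ d.argVars := d.ctx_fv hx
      simp [hx]

theorem isDescr_of_ground {α : GroundAction S} {p : Fml S × Fml S}
    (h : d.ground α = some p) : p.1.IsDescr k := by
  obtain ⟨e, -, rfl⟩ := d.ground_eq_some h
  have hfold : ∀ (l : List ℕ) (ψ : Fml S), (∀ x ∈ l, x < k) → ψ.IsDescr k →
      (l.foldr (fun x φ => Fml.and (.eq (.var x) (.name (e x))) φ) ψ).IsDescr k := by
    intro l ψ hl hψ
    induction l with
    | nil => exact hψ
    | cons a l ih =>
      obtain ⟨h₁, h₂⟩ := ih fun x hx => hl x (List.mem_cons_of_mem _ hx)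
      refine ⟨Finset.union_subset ?_ h₁, Finset.union_subset (by simp [Fml.bv]) h₂⟩
      have := hl a List.mem_cons_self
      simpa [Fml.fv, Term.vars] using this
  refine hfold _ _ (fun x hx => ?_) ⟨fun j hj => ?_, ?_⟩
  · simp only [List.mem_filter, List.mem_range] at hx
    exact hx.1
  · obtain ⟨y, hy, hj⟩ := Fml.exists_mem_fv_of_mem_subst _ _ hj
    by_cases hya : y ∈ d.argVars
    · simp [groundSubst, hya, Term.vars] at hj
    · simp only [groundSubst, hya, if_false, Term.vars, Finset.mem_singleton] at hj
      subst hj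
      exact (Finset.mem_union.1 (d.eff_fv hy)).resolve_right hya
  · refine Fml.bv_subst_subset _ _ _ d.eff_two Finset.subset_union_right fun y hy hyB => ?_
    by_cases hya : y ∈ d.argVars
    · simp [groundSubst, hya, Term.vars]
    · refine absurd (Finset.mem_union_left _ (Finset.mem_sdiff.2 ⟨?_, hya⟩)) hyB
      exact Finset.mem_union_left _ hy

theorem isC2Sentence_of_ground {α : GroundAction S} {p : Fml S × Fml S}
    (h : d.ground α = some p) : p.2.IsC2Sentence := by
  obtain ⟨e, -, rfl⟩ := d.ground_eq_some h
  have hname : ∀ y ∈ d.ctx.fv, (d.groundSubst e y).vars = ∅ := by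
    intro y hy
    have hy : y ∈ d.argVars := d.ctx_fv hy
    simp [groundSubst, hy, Term.vars]
  refine Fml.isC2Sentence_iff.2 ⟨Finset.eq_empty_of_forall_notMem fun j hj => ?_, ?_⟩
  · obtain ⟨y, hy, hj⟩ := Fml.exists_mem_fv_of_mem_subst _ _ hj
    simp [hname y hy] at hj
  · exact Fml.bv_subst_subset _ _ _ d.ctx_two subset_rfl fun y hy _ => hname y hy

theorem fluents_of_ground {α : GroundAction S} {p : Fml S × Fml S}
    (h : d.ground α = some p) : p.1.fluents ⊆ d.eff.fluents := by
  obtain ⟨e, -, rfl⟩ := d.ground_eq_some h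
  have hfold : ∀ (l : List ℕ) (ψ : Fml S),
      (l.foldr (fun x φ => Fml.and (.eq (.var x) (.name (e x))) φ) ψ).fluents = ψ.fluents := by
    intro l ψ
    induction l with
    | nil => rfl
    | cons a l ih => simp [Fml.fluents, ih]
  exact (hfold _ _).trans (Fml.fluents_subst _ _) |>.le

end Disjunct

/-! ### Depth of fluents -/

namespace BAT
variable {S : Signature} (D : BAT S)

/-- Along a chain of dependencies no fluent occurs twice. -/
theorem Acyclic.length_lt {D : BAT S} (h : D.Acyclic) {F : S.Flu} {l : List S.Flu}
    (hl : List.IsChain D.Dep (F :: l)) : l.length < Fintype.card S.Flu := by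
  have : IsTrans S.Flu (Relation.TransGen D.Dep) := ⟨fun _ _ _ => Relation.TransGen.trans⟩
  have hp : (F :: l).Pairwise (Relation.TransGen D.Dep) :=
    (hl.imp fun _ _ => Relation.TransGen.single).pairwise
  have hn : (F :: l).Nodup := hp.imp fun {a b} hab => by
    rintro rfl
    exact h a hab
  exact hn.length_le_card

theorem Acyclic.bddAbove {D : BAT S} (h : D.Acyclic) (F : S.Flu) :
    BddAbove {n | ∃ l : List S.Flu, List.IsChain D.Dep (F :: l) ∧ l.length = n} := by
  refine ⟨Fintype.card S.Flu, ?_⟩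
  rintro n ⟨l, hl, rfl⟩
  exact (h.length_lt hl).le

theorem Acyclic.fluentDepth_lt {D : BAT S} (h : D.Acyclic) {F F' : S.Flu} (hd : D.Dep F F') :
    D.fluentDepth F' < D.fluentDepth F := by
  have hne : {n | ∃ l : List S.Flu, List.IsChain D.Dep (F' :: l) ∧ l.length = n}.Nonempty :=
    ⟨0, [], by simp⟩
  obtain ⟨l, hl, hlen⟩ := Nat.sSup_mem hne (h.bddAbove F')
  refine Nat.lt_of_succ_le (le_csSup (h.bddAbove F) ⟨F' :: l, ?_, ?_⟩)
  · exact List.isChain_cons_cons.2 ⟨hd, hl⟩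
  · rw [List.length_cons, hlen]
    rfl

theorem fluentDepth_le_depth (F : S.Flu) : D.fluentDepth F ≤ D.depth :=
  Finset.le_sup (Finset.mem_univ F)

variable {D} {F : S.Flu} {α : GroundAction S} {p : Fml S × Fml S}

theorem mem_groundPos : p ∈ D.groundPos F α ↔ ∃ d ∈ D.pos F, d.ground α = some p := by
  simp [groundPos]

theorem mem_groundNeg : p ∈ D.groundNeg F α ↔ ∃ d ∈ D.neg F, d.ground α = some p := by
  simp [groundNeg]

theorem exists_holds_pos_iff {w : World S} {z : Trace S} {n : Fin (S.fluArity F) → S.Obj} :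
    (∃ d ∈ D.pos F, d.Holds w z α n) ↔ ∃ p ∈ D.groundPos F α,
      p.1.Holds w z (argEnv n) ∧ p.2.Holds w z (argEnv n) := by
  simp only [mem_groundPos, Disjunct.holds_iff_ground]
  grind

theorem exists_holds_neg_iff {w : World S} {z : Trace S} {n : Fin (S.fluArity F) → S.Obj} :
    (∃ d ∈ D.neg F, d.Holds w z α n) ↔ ∃ p ∈ D.groundNeg F α,
      p.1.Holds w z (argEnv n) ∧ p.2.Holds w z (argEnv n) := by
  simp only [mem_groundNeg, Disjunct.holds_iff_ground]
  grind

theorem isC2Sentence_of_mem_ground (h : p ∈ D.groundPos F α ∨ p ∈ D.groundNeg F α) :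
    p.2.IsC2Sentence := by
  rw [mem_groundPos, mem_groundNeg] at h
  rcases h with ⟨d, -, h⟩ | ⟨d, -, h⟩
  · exact d.isC2Sentence_of_ground h
  · exact d.isC2Sentence_of_ground h

theorem isDescr_of_mem_ground (h : p ∈ D.groundPos F α ∨ p ∈ D.groundNeg F α) :
    p.1.IsDescr (S.fluArity F) := by
  rw [mem_groundPos, mem_groundNeg] at h
  rcases h with ⟨d, -, h⟩ | ⟨d, -, h⟩
  · exact d.isDescr_of_ground h
  · exact d.isDescr_of_ground h

theorem Acyclic.fluentDepth_lt_of_mem_ground (hD : D.Acyclic)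
    (h : p ∈ D.groundPos F α ∨ p ∈ D.groundNeg F α) {F' : S.Flu} (hF' : F' ∈ p.1.fluents) :
    D.fluentDepth F' < D.fluentDepth F := by
  rw [mem_groundPos, mem_groundNeg] at h
  rcases h with ⟨d, hd, h⟩ | ⟨d, hd, h⟩
  · exact hD.fluentDepth_lt ⟨d, .inl hd, d.fluents_of_ground h hF'⟩
  · exact hD.fluentDepth_lt ⟨d, .inr hd, d.fluents_of_ground h hF'⟩

end BAT

theorem Prog.finite_actions {S : Signature} (δ : Prog S) : δ.actions.Finite := by
  induction δ with
  | act α => exact Set.finite_singleton α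
  | test φ => exact Set.finite_empty
  | seq _ _ ih₁ ih₂ => exact ih₁.union ih₂
  | choice _ _ ih₁ ih₂ => exact ih₁.union ih₂
  | par _ _ ih₁ ih₂ => exact ih₁.union ih₂
  | star _ ih => exact ih

/-! ### Relevant effects -/

theorem Set.Finite.finite_finsets_subset {β : Type*} {s : Set β} (hs : s.Finite) :
    {t : Finset β | ↑t ⊆ s}.Finite := by
  refine (hs.toFinset.powerset.finite_toSet).subset fun t ht => ?_
  simp only [Finset.coe_powerset, Set.mem_preimage, Set.mem_powerset_iff, Set.Finite.coe_toFinset]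
  exact ht

namespace GologProgram
open Classical
variable {S : Signature} (G : GologProgram S)

theorem finite_effPos (F : S.Flu) : (G.effPos F).Finite := by
  refine (G.prog.finite_actions.biUnion fun α _ =>
    ((G.bat.groundPos F α).map Prod.fst).toFinset.finite_toSet).subset ?_
  rintro ε ⟨α, hα, κ, h⟩
  exact Set.mem_biUnion hα (by simpa using ⟨κ, h⟩)

theorem finite_effNeg (F : S.Flu) : (G.effNeg F).Finite := by
  refine (G.prog.finite_actions.biUnion fun α _ =>
    ((G.bat.groundNeg F α).map Prod.fst).toFinset.finite_toSet).subset ?_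
  rintro ε ⟨α, hα, κ, h⟩
  exact Set.mem_biUnion hα (by simpa using ⟨κ, h⟩)

theorem finite_relEffectsBelow (i : ℕ) : (G.relEffectsBelow i).Finite := by
  induction i with
  | zero => exact Set.finite_empty
  | succ i ih =>
    have hE := ih.finite_finsets_subset
    have hX : ∀ F, {X : Finset (Fml S × Finset (Effect S)) |
        ↑X ⊆ G.effNeg F ×ˢ {E : Finset (Effect S) | ↑E ⊆ G.relEffectsBelow i}}.Finite :=
      fun F => ((G.finite_effNeg F).prod hE).finite_finsets_subset
    refine (ih.union ?_).union ?_
    · refine (Set.finite_iUnion fun F : S.Flu => ((G.finite_effNeg F).prod hE).image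
        fun p => Effect.del F (regress p.2 p.1)).subset ?_
      rintro e ⟨F, -, ε, hε, E, hE, rfl⟩
      exact Set.mem_iUnion.2 ⟨F, (ε, E), ⟨hε, hE⟩, rfl⟩
    · refine (Set.finite_iUnion fun F : S.Flu => (((G.finite_effPos F).prod hE).prod (hX F)).image
        fun p => Effect.add F (regress p.1.2 p.1.1)
          (p.2.image fun q => regress q.2 q.1)).subset ?_
      rintro e ⟨F, -, φ, hφ, E, hE, X, hX, rfl⟩
      exact Set.mem_iUnion.2 ⟨F, ((φ, E), X), ⟨⟨hφ, hE⟩, fun p hp => hX p hp⟩, rfl⟩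

theorem finite_relEffects : G.relEffects.Finite := G.finite_relEffectsBelow _

theorem relEffectsBelow_mono {i j : ℕ} (h : i ≤ j) : G.relEffectsBelow i ⊆ G.relEffectsBelow j := by
  induction h with
  | refl => rfl
  | step _ ih => exact ih.trans fun e he => .inl (.inl he)

theorem isWF_of_mem_relEffectsBelow {i : ℕ} {e : Effect S} (h : e ∈ G.relEffectsBelow i) :
    e.IsWF := by
  induction i generalizing e with
  | zero => exact h.elim
  | succ i ih =>
    have neg : ∀ {F ε} {E : Finset (Effect S)}, ε ∈ G.effNeg F → ↑E ⊆ G.relEffectsBelow i →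
        (regress E ε).IsDescr (S.fluArity F) := by
      rintro F ε E ⟨α, -, κ, h⟩ hE
      exact (BAT.isDescr_of_mem_ground (.inr h)).regress fun e he => ih (hE he)
    rcases h with (h | ⟨F, -, ε, hε, E, hE, rfl⟩) | ⟨F, -, φ, ⟨α, -, κ, h⟩, E, hE, X, hX, rfl⟩
    · exact ih h
    · exact neg hε hE
    · refine ⟨(BAT.isDescr_of_mem_ground (.inl h)).regress fun e he => ih (hE he), ?_⟩
      simp only [Finset.forall_mem_image]
      exact fun p hp => neg (hX p hp).1 (hX p hp).2

theorem isWF_of_mem_relEffects {e : Effect S} (h : e ∈ G.relEffects) : e.IsWF :=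
  G.isWF_of_mem_relEffectsBelow h

theorem isWF_of_subset_relEffects {E : Finset (Effect S)} (h : ↑E ⊆ G.relEffects) :
    ∀ e ∈ E, e.IsWF :=
  fun _ he => G.isWF_of_mem_relEffects (h he)

theorem del_mem_relEffects {F : S.Flu} {ψ : Fml S} : Effect.del F ψ ∈ G.relEffects ↔
    ∃ ε ∈ G.effNeg F, ∃ E : Finset (Effect S),
      ↑E ⊆ G.relEffectsBelow (G.bat.fluentDepth F) ∧ ψ = regress E ε := by
  constructor
  · suffices ∀ i, Effect.del F ψ ∈ G.relEffectsBelow i → _ from this _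
    intro i h
    induction i with
    | zero => exact h.elim
    | succ i ih =>
      rcases h with (h | ⟨F', hd, ε, hε, E, hE, h⟩) | ⟨F', -, φ, -, E, -, X, -, h⟩
      · exact ih h
      · obtain ⟨rfl, rfl⟩ := Effect.del.inj h
        exact ⟨ε, hε, E, hd ▸ hE, rfl⟩
      · simp at h
  · rintro ⟨ε, hε, E, hE, rfl⟩
    exact G.relEffectsBelow_mono (Nat.succ_le_succ (G.bat.fluentDepth_le_depth F))
      (.inl (.inr ⟨F, rfl, ε, hε, E, hE, rfl⟩))

theorem add_mem_relEffects {F : S.Flu} {ψ : Fml S} {N : Finset (Fml S)} :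
    Effect.add F ψ N ∈ G.relEffects ↔
    ∃ φ ∈ G.effPos F, ∃ E : Finset (Effect S), ↑E ⊆ G.relEffectsBelow (G.bat.fluentDepth F) ∧
      ∃ X : Finset (Fml S × Finset (Effect S)),
        (∀ p ∈ X, p.1 ∈ G.effNeg F ∧ ↑p.2 ⊆ G.relEffectsBelow (G.bat.fluentDepth F)) ∧
        ψ = regress E φ ∧ N = X.image fun p => regress p.2 p.1 := by
  constructor
  · suffices ∀ i, Effect.add F ψ N ∈ G.relEffectsBelow i → _ from this _
    intro i h
    induction i with
    | zero => exact h.elim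
    | succ i ih =>
      rcases h with (h | ⟨F', hd, ε, hε, E, hE, h⟩) | ⟨F', hd, φ, hφ, E, hE, X, hX, h⟩
      · exact ih h
      · simp at h
      · obtain ⟨rfl, rfl, rfl⟩ := Effect.add.inj h
        exact ⟨φ, hφ, E, hd ▸ hE, X, fun p hp => ⟨(hX p hp).1, hd ▸ (hX p hp).2⟩, rfl, rfl⟩
  · rintro ⟨φ, hφ, E, hE, X, hX, rfl, rfl⟩
    exact G.relEffectsBelow_mono (Nat.succ_le_succ (G.bat.fluentDepth_le_depth F))
      (.inr ⟨F, rfl, φ, hφ, E, hE, X, hX, rfl⟩)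

/-- A relevant effect enters at the stage given by the depth of its fluent. -/
theorem mem_relEffectsBelow_of_fluentDepth_lt {e : Effect S} (h : e ∈ G.relEffects) {i : ℕ}
    (hi : G.bat.fluentDepth e.fluent < i) : e ∈ G.relEffectsBelow i := by
  refine G.relEffectsBelow_mono (Nat.succ_le_of_lt hi) ?_
  rcases e with ⟨F, ψ, N⟩ | ⟨F, ψ⟩
  · obtain ⟨φ, hφ, E, hE, X, hX, rfl, rfl⟩ := G.add_mem_relEffects.1 h
    exact .inr ⟨F, rfl, φ, hφ, E, hE, X, hX, rfl⟩
  · obtain ⟨ε, hε, E, hE, rfl⟩ := G.del_mem_relEffects.1 h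
    exact .inl (.inr ⟨F, rfl, ε, hε, E, hE, rfl⟩)

variable {G}

/-- By acyclicity, a descriptor of `F` mentions only fluents of smaller depth, so only the effects
on those matter when it is regressed. -/
theorem exists_regress_eq (hG : G.bat.Acyclic) {E : Finset (Effect S)} (hE : ↑E ⊆ G.relEffects)
    {F : S.Flu} {ε : Fml S} (hε : ε ∈ G.effPos F ∨ ε ∈ G.effNeg F) :
    ∃ E' : Finset (Effect S), ↑E' ⊆ G.relEffectsBelow (G.bat.fluentDepth F) ∧
      regress E ε = regress E' ε := by
  refine ⟨E.filter fun e => G.bat.fluentDepth e.fluent < G.bat.fluentDepth F, ?_, ?_⟩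
  · intro e he
    obtain ⟨he, hd⟩ := Finset.mem_filter.1 he
    exact G.mem_relEffectsBelow_of_fluentDepth_lt (hE he) hd
  · symm
    refine regress_filter E ε (fun F' => G.bat.fluentDepth F' < G.bat.fluentDepth F) ?_
    rcases hε with ⟨α, -, κ, h⟩ | ⟨α, -, κ, h⟩
    · exact fun F' hF' => hG.fluentDepth_lt_of_mem_ground (.inl h) hF'
    · exact fun F' hF' => hG.fluentDepth_lt_of_mem_ground (.inr h) hF'

theorem add_mem_execEffects {τ : Set (Fml S × Finset (Effect S))} {E : Finset (Effect S)}
    {α : GroundAction S} {F : S.Flu} {φ : Fml S} {N : Finset (Fml S)} :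
    Effect.add F φ N ∈ G.execEffects τ E α ↔
      N = ∅ ∧ ∃ κ, (φ, κ) ∈ G.bat.groundPos F α ∧ (κ, E) ∈ τ := by
  simp only [execEffects, Finset.mem_biUnion, Finset.mem_union, Finset.mem_image,
    Finset.mem_filter, List.mem_toFinset, Finset.mem_univ, true_and]
  constructor
  · rintro ⟨F', ⟨p, ⟨hp, hτ⟩, h⟩ | ⟨p, ⟨hp, hτ⟩, h⟩⟩
    · obtain ⟨rfl, rfl, rfl⟩ := Effect.add.inj h
      exact ⟨rfl, p.2, hp, hτ⟩
    · simp at h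
  · rintro ⟨rfl, κ, hp, hτ⟩
    exact ⟨F, .inl ⟨(φ, κ), ⟨hp, hτ⟩, rfl⟩⟩

theorem del_mem_execEffects {τ : Set (Fml S × Finset (Effect S))} {E : Finset (Effect S)}
    {α : GroundAction S} {F : S.Flu} {φ : Fml S} :
    Effect.del F φ ∈ G.execEffects τ E α ↔
      ∃ κ, (φ, κ) ∈ G.bat.groundNeg F α ∧ (κ, E) ∈ τ := by
  simp only [execEffects, Finset.mem_biUnion, Finset.mem_union, Finset.mem_image,
    Finset.mem_filter, List.mem_toFinset, Finset.mem_univ, true_and]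
  constructor
  · rintro ⟨F', ⟨p, ⟨hp, hτ⟩, h⟩ | ⟨p, ⟨hp, hτ⟩, h⟩⟩
    · simp at h
    · obtain ⟨rfl, rfl⟩ := Effect.del.inj h
      exact ⟨p.2, hp, hτ⟩
  · rintro ⟨κ, hp, hτ⟩
    exact ⟨F, .inr ⟨(φ, κ), ⟨hp, hτ⟩, rfl⟩⟩

/-- The relevant effects are closed under executing an action of the program. -/
theorem accumulate_subset_relEffects (hG : G.bat.Acyclic)
    {τ : Set (Fml S × Finset (Effect S))} {E : Finset (Effect S)} (hE : ↑E ⊆ G.relEffects)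
    {α : GroundAction S} (hα : α ∈ G.prog.actions) :
    ↑(accumulate E (G.execEffects τ E α)) ⊆ G.relEffects := by
  have hneg : ∀ {F ε}, Effect.del F ε ∈ G.execEffects τ E α → ε ∈ G.effNeg F := by
    intro F ε h
    obtain ⟨κ, h, -⟩ := del_mem_execEffects.1 h
    exact ⟨α, hα, κ, h⟩
  rintro (⟨F, ψ, M⟩ | ⟨F, ψ⟩) he
  · rcases add_mem_accumulate.1 (Finset.mem_coe.1 he) with ⟨φ, N, h, rfl, rfl⟩ | ⟨N, h, rfl⟩
    · obtain ⟨rfl, κ, h, -⟩ := add_mem_execEffects.1 h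
      have hφ : φ ∈ G.effPos F := ⟨α, hα, κ, h⟩
      obtain ⟨E', hE', heq⟩ := exists_regress_eq hG hE (.inl hφ)
      exact G.add_mem_relEffects.2 ⟨φ, hφ, E', hE', ∅, by simp, heq, by simp⟩
    · obtain ⟨φ, hφ, E', hE', X, hX, rfl, rfl⟩ := G.add_mem_relEffects.1 (hE h)
      have : ∀ ε ∈ delDescr (G.execEffects τ E α) F, ∃ E' : Finset (Effect S),
          ↑E' ⊆ G.relEffectsBelow (G.bat.fluentDepth F) ∧ regress E ε = regress E' ε :=
        fun ε hε => exists_regress_eq hG hE (.inr (hneg (mem_delDescr.1 hε)))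
      choose! f hf₁ hf₂ using this
      -- The new negative descriptors extend the set of negated regressed descriptors.
      refine G.add_mem_relEffects.2 ⟨φ, hφ, E', hE',
        X ∪ (delDescr (G.execEffects τ E α) F).image fun ε => (ε, f ε), ?_, rfl, ?_⟩
      · intro p hp
        rcases Finset.mem_union.1 hp with hp | hp
        · exact hX p hp
        · obtain ⟨ε, hε, rfl⟩ := Finset.mem_image.1 hp
          exact ⟨hneg (mem_delDescr.1 hε), hf₁ ε hε⟩
      · rw [Finset.image_union, Finset.image_image]
        congr 1
        exact Finset.image_congr fun ε hε => hf₂ ε hε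
  · rcases del_mem_accumulate.1 (Finset.mem_coe.1 he) with ⟨φ, h, rfl⟩ | h
    · obtain ⟨E', hE', heq⟩ := exists_regress_eq hG hE (.inr (hneg h))
      exact G.del_mem_relEffects.2 ⟨φ, hneg h, E', hE', heq⟩
    · exact hE h

/-- The effects of executing `α` are those that the successor state axioms prescribe, provided that
`(τ, E)` contains exactly the context conditions that are true. -/
theorem applyEffects_execEffects {w : World S} (hw : G.bat.Models w) {z : Trace S}
    {τ : Set (Fml S × Finset (Effect S))} {E : Finset (Effect S)} {α : GroundAction S}
    (hτ : ∀ F, ∀ p, p ∈ G.bat.groundPos F α ∨ p ∈ G.bat.groundNeg F α →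
      ((p.2, E) ∈ τ ↔ p.2.Sat w z)) (F : S.Flu) (n : Fin (S.fluArity F) → S.Obj) :
    applyEffects (G.execEffects τ E α) w F n z ↔ w F n (z ++ [α]) := by
  have hctx : ∀ p, p ∈ G.bat.groundPos F α ∨ p ∈ G.bat.groundNeg F α →
      ((p.2, E) ∈ τ ↔ p.2.Holds w z (argEnv n)) := fun p hp =>
    (hτ F p hp).trans (Fml.sat_iff_holds (BAT.isC2Sentence_of_mem_ground hp).1 _)
  rw [hw.2, BAT.exists_holds_pos_iff, BAT.exists_holds_neg_iff, applyEffects_iff, or_comm]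
  simp only [add_mem_execEffects, del_mem_execEffects]
  refine or_congr ⟨?_, ?_⟩ (and_congr_right fun _ => ?_)
  · rintro ⟨φ, _, ⟨rfl, κ, hp, hκ⟩, hφ, -⟩
    exact ⟨(φ, κ), hp, hφ, (hctx _ (.inl hp)).1 hκ⟩
  · rintro ⟨⟨φ, κ⟩, hp, hφ, hκ⟩
    exact ⟨φ, ∅, ⟨rfl, κ, hp, (hctx _ (.inl hp)).2 hκ⟩, hφ, by simp⟩
  · rw [not_exists]
    constructor
    · rintro h ⟨ε, κ⟩ ⟨hp, hε, hκ⟩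
      exact h ε ⟨κ, hp, (hctx _ (.inr hp)).2 hκ⟩ hε
    · rintro h ε ⟨κ, hp, hκ⟩ hε
      exact h (ε, κ) ⟨hp, hε, (hctx _ (.inr hp)).1 hκ⟩

end GologProgram

/-! ### Characteristic graphs and the transition semantics of programs -/

namespace Prog
variable {S : Signature}

theorem self_mem_sub (δ : Prog S) : δ ∈ δ.sub := Relation.ReflTransGen.refl

theorem sub_step {δ ρ ρ' : Prog S} {α : GroundAction S} {ψ : Fml S} (h : ρ ∈ δ.sub)
    (he : Edge ρ α ψ ρ') : ρ' ∈ δ.sub :=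
  Relation.ReflTransGen.tail h ⟨α, ψ, he⟩

theorem sub_induction {δ : Prog S} {p : Prog S → Prop} (h₀ : p δ)
    (hs : ∀ ρ α ψ ρ', p ρ → Edge ρ α ψ ρ' → p ρ') : ∀ ρ ∈ δ.sub, p ρ := by
  intro ρ h
  induction h with
  | refl => exact h₀
  | tail _ h ih =>
    obtain ⟨α, ψ, h⟩ := h
    exact hs _ _ _ _ ih h

/-- The characteristic graph is finite: reachable programs have a shape given by the program and
reachable programs of its parts. -/
theorem finite_sub (δ : Prog S) : δ.sub.Finite := by
  induction δ with
  | act α =>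
    refine (Set.toFinite {act α, nil}).subset (sub_induction (.inl rfl) ?_)
    rintro ρ β ψ ρ' (rfl | rfl) h
    · cases h
      exact .inr rfl
    · cases h
  | test φ =>
    refine (Set.finite_singleton (test φ)).subset (sub_induction rfl ?_)
    rintro ρ β ψ ρ' rfl h
    cases h
  | seq δ₁ δ₂ ih₁ ih₂ =>
    refine ((ih₁.image fun ρ => seq ρ δ₂).union ih₂).subset
      (sub_induction (.inl ⟨δ₁, self_mem_sub _, rfl⟩) ?_)
    rintro ρ β ψ ρ' (⟨ρ₁, hρ, rfl⟩ | hρ) h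
    · cases h with
      | seq_left h => exact .inl ⟨_, sub_step hρ h, rfl⟩
      | seq_right h => exact .inr (sub_step (self_mem_sub _) h)
    · exact .inr (sub_step hρ h)
  | choice δ₁ δ₂ ih₁ ih₂ =>
    refine ((Set.finite_singleton (choice δ₁ δ₂)).union (ih₁.union ih₂)).subset
      (sub_induction (.inl rfl) ?_)
    rintro ρ β ψ ρ' (rfl | hρ | hρ) h
    · cases h with
      | choice_left h => exact .inr (.inl (sub_step (self_mem_sub _) h))
      | choice_right h => exact .inr (.inr (sub_step (self_mem_sub _) h))
    · exact .inr (.inl (sub_step hρ h))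
    · exact .inr (.inr (sub_step hρ h))
  | par δ₁ δ₂ ih₁ ih₂ =>
    refine (ih₁.image2 par ih₂).subset
      (sub_induction ⟨δ₁, self_mem_sub _, δ₂, self_mem_sub _, rfl⟩ ?_)
    rintro _ β ψ ρ' ⟨ρ₁, h₁, ρ₂, h₂, rfl⟩ h
    cases h with
    | par_left h => exact ⟨_, sub_step h₁ h, _, h₂, rfl⟩
    | par_right h => exact ⟨_, h₁, _, sub_step h₂ h, rfl⟩
  | star δ ih =>
    refine ((Set.finite_singleton (star δ)).union (ih.image fun ρ => seq ρ (star δ))).subset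
      (sub_induction (.inl rfl) ?_)
    have hstar : ∀ {β ψ ρ'}, Edge (star δ) β ψ ρ' →
        ρ' ∈ (fun ρ => seq ρ (star δ)) '' δ.sub := by
      rintro β ψ ρ' h
      cases h with
      | star h => exact ⟨_, sub_step (self_mem_sub _) h, rfl⟩
    rintro ρ β ψ ρ' (rfl | ⟨ρ₁, hρ, rfl⟩) h
    · exact .inr (hstar h)
    · cases h with
      | seq_left h => exact .inr ⟨_, sub_step hρ h, rfl⟩
      | seq_right h => exact .inr (hstar h)

theorem Edge.mem_actions {δ ρ : Prog S} {α : GroundAction S} {ψ : Fml S} (h : Edge δ α ψ ρ) :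
    α ∈ δ.actions ∧ ρ.actions ⊆ δ.actions := by
  induction h <;> simp only [actions, nil] <;> grind

theorem isC2Sentence_term {δ : Prog S} (h : δ.TestsC2) : δ.term.IsC2Sentence := by
  induction δ with
  | act α => exact Fml.isC2Sentence_top.neg
  | test φ => exact h
  | seq δ₁ δ₂ ih₁ ih₂ => exact (ih₁ h.1).and (ih₂ h.2)
  | choice δ₁ δ₂ ih₁ ih₂ => exact (ih₁ h.1).or (ih₂ h.2)
  | par δ₁ δ₂ ih₁ ih₂ => exact (ih₁ h.1).and (ih₂ h.2)
  | star δ ih => exact Fml.isC2Sentence_top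

theorem Edge.isC2 {δ ρ : Prog S} {α : GroundAction S} {ψ : Fml S} (h : Edge δ α ψ ρ)
    (hδ : δ.TestsC2) : ψ.IsC2Sentence ∧ ρ.TestsC2 := by
  induction h with
  | act => exact ⟨Fml.isC2Sentence_top, Fml.isC2Sentence_top⟩
  | seq_left _ ih => exact ⟨(ih hδ.1).1, (ih hδ.1).2, hδ.2⟩
  | seq_right _ ih => exact ⟨(isC2Sentence_term hδ.1).and (ih hδ.2).1, (ih hδ.2).2⟩
  | choice_left _ ih => exact ih hδ.1
  | choice_right _ ih => exact ih hδ.2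
  | par_left _ ih => exact ⟨(ih hδ.1).1, (ih hδ.1).2, hδ.2⟩
  | par_right _ ih => exact ⟨(ih hδ.2).1, hδ.1, (ih hδ.2).2⟩
  | star _ ih => exact ⟨(ih hδ).1, (ih hδ).2, hδ⟩

theorem testsC2_of_mem_sub {δ ρ : Prog S} (h : δ.TestsC2) (hρ : ρ ∈ δ.sub) : ρ.TestsC2 :=
  sub_induction (p := TestsC2) h (fun _ _ _ _ hρ he => (he.isC2 hρ).2) ρ hρ

theorem actions_subset_of_mem_sub {δ ρ : Prog S} (hρ : ρ ∈ δ.sub) : ρ.actions ⊆ δ.actions :=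
  sub_induction (p := fun ρ => ρ.actions ⊆ δ.actions) subset_rfl
    (fun _ _ _ _ hρ he => he.mem_actions.2.trans hρ) ρ hρ

theorem final_iff_term {w : World S} {z : Trace S} {δ : Prog S} (h : δ.TestsC2) :
    Final w z δ ↔ δ.term.Sat w z := by
  induction δ with
  | act α =>
    refine iff_of_false (fun h => nomatch h) fun hs => ?_
    obtain ⟨e⟩ : Nonempty (ℕ → S.Obj) := inferInstance
    exact hs e trivial
  | test φ => exact ⟨fun | .test h => h, .test⟩
  | seq δ₁ δ₂ ih₁ ih₂ =>
    rw [term, Fml.sat_and, ← ih₁ h.1, ← ih₂ h.2]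
    exact ⟨fun | .seq h₁ h₂ => ⟨h₁, h₂⟩, fun h => .seq h.1 h.2⟩
  | choice δ₁ δ₂ ih₁ ih₂ =>
    rw [term, Fml.sat_or (isC2Sentence_term h.1).1 (isC2Sentence_term h.2).1, ← ih₁ h.1,
      ← ih₂ h.2]
    exact ⟨fun | .choice_left h => .inl h | .choice_right h => .inr h,
      fun | .inl h => .choice_left h | .inr h => .choice_right h⟩
  | par δ₁ δ₂ ih₁ ih₂ =>
    rw [term, Fml.sat_and, ← ih₁ h.1, ← ih₂ h.2]
    exact ⟨fun | .par h₁ h₂ => ⟨h₁, h₂⟩, fun h => .par h.1 h.2⟩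
  | star δ ih => exact iff_of_true .star fun _ => trivial

theorem Edge.trans {w : World S} {z : Trace S} {δ ρ : Prog S} {α : GroundAction S} {ψ : Fml S}
    (h : Edge δ α ψ ρ) (hδ : δ.TestsC2) (hψ : ψ.Sat w z) :
    Trans w (z, δ) (z ++ [α], ρ) := by
  induction h with
  | act => exact .act
  | seq_left _ ih => exact .seq_left (ih hδ.1 hψ)
  | seq_right _ ih =>
    rw [Fml.sat_and] at hψ
    exact .seq_right ((final_iff_term hδ.1).2 hψ.1) (ih hδ.2 hψ.2)
  | choice_left _ ih => exact .choice_left (ih hδ.1 hψ)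
  | choice_right _ ih => exact .choice_right (ih hδ.2 hψ)
  | par_left _ ih => exact .par_left (ih hδ.1 hψ)
  | par_right _ ih => exact .par_right (ih hδ.2 hψ)
  | star _ ih => exact .star (ih hδ hψ)

theorem Trans.exists_edge {w : World S} {z z' : Trace S} {δ ρ : Prog S}
    (h : Trans w (z, δ) (z', ρ)) (hδ : δ.TestsC2) :
    ∃ α ψ, z' = z ++ [α] ∧ Edge δ α ψ ρ ∧ ψ.Sat w z := by
  generalize hc : (z, δ) = c at h
  generalize hc' : (z', ρ) = c' at h
  induction h generalizing z z' δ ρ with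
  | act =>
    cases hc; cases hc'
    exact ⟨_, _, rfl, .act, Fml.sat_top⟩
  | seq_left _ ih =>
    cases hc; cases hc'
    obtain ⟨α, ψ, hz, he, hs⟩ := ih hδ.1 rfl rfl
    exact ⟨α, ψ, hz, .seq_left he, hs⟩
  | seq_right hf _ ih =>
    cases hc; cases hc'
    obtain ⟨α, ψ, hz, he, hs⟩ := ih hδ.2 rfl rfl
    exact ⟨α, _, hz, .seq_right he, Fml.sat_and.2 ⟨(final_iff_term hδ.1).1 hf, hs⟩⟩
  | choice_left _ ih =>
    cases hc; cases hc'
    obtain ⟨α, ψ, hz, he, hs⟩ := ih hδ.1 rfl rfl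
    exact ⟨α, ψ, hz, .choice_left he, hs⟩
  | choice_right _ ih =>
    cases hc; cases hc'
    obtain ⟨α, ψ, hz, he, hs⟩ := ih hδ.2 rfl rfl
    exact ⟨α, ψ, hz, .choice_right he, hs⟩
  | par_left _ ih =>
    cases hc; cases hc'
    obtain ⟨α, ψ, hz, he, hs⟩ := ih hδ.1 rfl rfl
    exact ⟨α, ψ, hz, .par_left he, hs⟩
  | par_right _ ih =>
    cases hc; cases hc'
    obtain ⟨α, ψ, hz, he, hs⟩ := ih hδ.2 rfl rfl
    exact ⟨α, ψ, hz, .par_right he, hs⟩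
  | star _ ih =>
    cases hc; cases hc'
    obtain ⟨α, ψ, hz, he, hs⟩ := ih (by exact hδ) rfl rfl
    exact ⟨α, ψ, hz, .star he, hs⟩

end Prog

/-! ### Temporal formulas on finite traces -/

/-- `p U q` on a finite trace: at some position `q` holds, and `p` holds at all earlier ones. -/
def UntilOn {S : Signature} (p q : Trace S → Trace S → Prop) : Trace S → Trace S → Prop
  | z, [] => q z []
  | z, α :: z' => q z (α :: z') ∨ (p z (α :: z') ∧ UntilOn p q (z ++ [α]) z')

theorem untilOn_congr {S : Signature} {p p' q q' : Trace S → Trace S → Prop}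
    (hp : ∀ z α z', p z (α :: z') ↔ p' z (α :: z')) (hq : ∀ z z', q z z' ↔ q' z z')
    (z z' : Trace S) : UntilOn p q z z' ↔ UntilOn p' q' z z' := by
  induction z' generalizing z with
  | nil => exact hq z []
  | cons α z' ih => simp only [UntilOn, hp, hq, ih]

theorem Goal.sat_untl {S : Signature} {w : World S} {Φ Ψ : Goal S} (z z' : Trace S) :
    (untl Φ Ψ).Sat w z z' ↔ UntilOn (fun z z' => Φ.Sat w z z') (fun z z' => Ψ.Sat w z z') z z' := by
  induction z' generalizing z with
  | nil => simp [Sat, UntilOn]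
  | cons α z' ih =>
    rw [UntilOn, ← ih]
    simp only [Sat]
    constructor
    · rintro ⟨k, hk, hΨ, hΦ⟩
      rcases k with _ | k
      · exact .inl (by simpa using hΨ)
      · refine .inr ⟨by simpa using hΦ 0 (by omega), k, by simpa using hk, by simpa using hΨ, ?_⟩
        intro i hi
        simpa using hΦ (i + 1) (by omega)
    · rintro (h | ⟨h, k, hk, hΨ, hΦ⟩)
      · exact ⟨0, by simp, by simpa using h, by simp⟩
      · refine ⟨k + 1, by simpa using hk, by simpa using hΨ, ?_⟩
        rintro (_ | i) hi
        · simpa using h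
        · simpa using hΦ i (by omega)

namespace TNF
variable {S : Signature}

/-- Truth of a formula on the finite trace `z'` that remains after `z`, where `Tail` holds at the
last position only. Next is strong, and `Φ R Ψ` is read as `Ψ U (Φ ∧ Ψ)`, so that the unfolding
performed by `xnf` is an equivalence also at the last position. In a tail normal form the left
operand of `R` has `Tail` as a disjunct, and this reading agrees with the usual one. -/
def Holds (w : World S) : TNF S → Trace S → Trace S → Prop
  | lit φ, z, _ => φ.Sat w z
  | nlit φ, z, _ => ¬ φ.Sat w z
  | tail, _, z' => z' = []
  | ntail, _, z' => z' ≠ []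
  | and Φ Ψ, z, z' => Φ.Holds w z z' ∧ Ψ.Holds w z z'
  | or Φ Ψ, z, z' => Φ.Holds w z z' ∨ Ψ.Holds w z z'
  | next Φ, z, z' => ∃ α z'', z' = α :: z'' ∧ Φ.Holds w (z ++ [α]) z''
  | untl Φ Ψ, z, z' => UntilOn (Φ.Holds w) (Ψ.Holds w) z z'
  | rels Φ Ψ, z, z' => UntilOn (Ψ.Holds w) (fun z z' => Φ.Holds w z z' ∧ Ψ.Holds w z z') z z'

/-- The unfolding of until and release by `xnf` preserves truth. -/
theorem holds_xnf {w : World S} (Θ : TNF S) (z z' : Trace S) :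
    Θ.xnf.Holds w z z' ↔ Θ.Holds w z z' := by
  induction Θ with
  | lit φ => rfl
  | nlit φ => rfl
  | tail => rfl
  | ntail => rfl
  | and Φ Ψ ih₁ ih₂ => simp only [xnf, Holds, ih₁, ih₂]
  | or Φ Ψ ih₁ ih₂ => simp only [xnf, Holds, ih₁, ih₂]
  | next Φ _ => rfl
  | untl Φ Ψ ih₁ ih₂ =>
    simp only [xnf, Holds, ih₁, ih₂]
    cases z' with
    | nil => simp [UntilOn]
    | cons α z' => simp [UntilOn]
  | rels Φ Ψ ih₁ ih₂ =>
    simp only [xnf, Holds, ih₁, ih₂]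
    cases z' with
    | nil => simp [UntilOn, and_comm]
    | cons α z' => simp [UntilOn]; tauto

/-- Formulas that are built from literals, `Tail` and next by conjunction and disjunction. -/
def IsXnf : TNF S → Prop
  | and Φ Ψ => Φ.IsXnf ∧ Ψ.IsXnf
  | or Φ Ψ => Φ.IsXnf ∧ Ψ.IsXnf
  | untl _ _ => False
  | rels _ _ => False
  | _ => True

theorem isXnf_xnf (Θ : TNF S) : Θ.xnf.IsXnf := by
  induction Θ <;> simp_all [xnf, IsXnf]

theorem self_mem_cl (Θ : TNF S) : Θ ∈ Θ.cl := by
  cases Θ <;> simp [cl]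

theorem cl_subset {Θ Ψ : TNF S} (h : Θ ∈ Ψ.cl) : Θ.cl ⊆ Ψ.cl := by
  induction Ψ <;>
    simp only [cl, Set.mem_union, Set.mem_insert_iff, Set.mem_singleton_iff] at h ⊢ <;>
    grind [cl]

theorem sentences_subset {Θ Ψ : TNF S} (h : Θ ∈ Ψ.cl) : Θ.sentences ⊆ Ψ.sentences := by
  induction Ψ <;>
    simp only [cl, Set.mem_union, Set.mem_insert_iff, Set.mem_singleton_iff] at h ⊢ <;>
    grind [sentences]

theorem finite_cl (Θ : TNF S) : Θ.cl.Finite := by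
  induction Θ with
  | and Φ Ψ ih₁ ih₂ => exact ((Set.finite_singleton _).union ih₁).union ih₂
  | or Φ Ψ ih₁ ih₂ => exact ((Set.finite_singleton _).union ih₁).union ih₂
  | next Φ ih => exact (Set.finite_singleton _).union ih
  | untl Φ Ψ ih₁ ih₂ => exact ((Set.finite_singleton _).union ih₁).union ih₂
  | rels Φ Ψ ih₁ ih₂ => exact ((Set.finite_singleton _).union ih₁).union ih₂
  | _ => simp [cl]

theorem finite_sentences (Θ : TNF S) : Θ.sentences.Finite := by
  induction Θ with
  | and Φ Ψ ih₁ ih₂ => exact ih₁.union ih₂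
  | or Φ Ψ ih₁ ih₂ => exact ih₁.union ih₂
  | next Φ ih => exact ih
  | untl Φ Ψ ih₁ ih₂ => exact ih₁.union ih₂
  | rels Φ Ψ ih₁ ih₂ => exact ih₁.union ih₂
  | _ => simp [sentences]

theorem mem_sentences_of_mem_propAtoms {Θ : TNF S} {φ : Fml S} (h : lit φ ∈ Θ.xnf.propAtoms) :
    φ ∈ Θ.sentences := by
  induction Θ <;> simp [xnf, propAtoms, sentences] at h ⊢ <;> tauto

theorem mem_cl_of_mem_propAtoms {Θ Ψ : TNF S} (h : next Ψ ∈ Θ.xnf.propAtoms) : Ψ ∈ Θ.cl := by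
  induction Θ with
  | lit φ => simp [xnf, propAtoms] at h
  | nlit φ => simp [xnf, propAtoms] at h
  | tail => simp [xnf, propAtoms] at h
  | ntail => simp [xnf, propAtoms] at h
  | and Φ Ψ ih₁ ih₂ => exact h.elim (fun h => .inl (.inr (ih₁ h))) fun h => .inr (ih₂ h)
  | or Φ Ψ ih₁ ih₂ => exact h.elim (fun h => .inl (.inr (ih₁ h))) fun h => .inr (ih₂ h)
  | next Φ ih =>
    obtain rfl : _ = Φ := by simpa [xnf, propAtoms] using h
    exact .inr (self_mem_cl _)
  | untl Φ Ψ ih₁ ih₂ =>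
    rcases h with h | h | h
    · exact .inr (ih₂ h)
    · exact .inl (.inr (ih₁ h))
    · exact .inl (.inl (next.inj h))
  | rels Φ Ψ ih₁ ih₂ =>
    rcases h with h | h | h
    · exact .inr (ih₂ h)
    · exact .inl (.inr (ih₁ h))
    · exact .inl (.inl (next.inj h))

theorem IsAssignment.nextPart_subset {χ : Set (TNF S)} {P : TNF S → Option Bool}
    (hP : IsAssignment χ P) {C : Set (TNF S)} (hC : ∀ Θ ∈ χ, Θ.cl ⊆ C) : nextPart P ⊆ C := by
  intro Ψ hΨ
  have hΨ : P (next Ψ) = some true := hΨ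
  obtain ⟨Θ, hΘ, h⟩ := hP.1 (next Ψ) (by simp [hΨ])
  exact hC Θ hΘ (mem_cl_of_mem_propAtoms h)

/-- An assignment that is locally true, and whose obligations are met in the remaining trace, makes
only true formulas true. -/
theorem holds_of_propSat {w : World S} {z z' : Trace S} {P : TNF S → Option Bool}
    (hloc : ∀ ψ ∈ localPart P, ψ.Sat w z) (hneg : ∀ φ, (Fml.neg φ).Sat w z → ¬ φ.Sat w z)
    (htail : tailPart P = true ↔ z' = [])
    (hnext : ∀ Θ ∈ nextPart P, (next Θ).Holds w z z') {Θ : TNF S} (hx : Θ.IsXnf)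
    (h : PropSat P Θ) : Θ.Holds w z z' := by
  induction Θ with
  | lit φ => exact hloc φ (.inl h)
  | nlit φ => exact hneg φ (hloc _ (.inr ⟨φ, h, rfl⟩))
  | tail =>
    have h : P tail = some true := h
    exact htail.1 (by simp [tailPart, h])
  | ntail =>
    intro hz
    have h₁ := htail.2 hz
    have h₂ : P tail = some false := h
    simp [tailPart, h₂] at h₁
  | and Φ Ψ ih₁ ih₂ => exact ⟨ih₁ hx.1 h.1, ih₂ hx.2 h.2⟩
  | or Φ Ψ ih₁ ih₂ => exact h.imp (ih₁ hx.1) (ih₂ hx.2)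
  | next Φ ih => exact hnext Φ h
  | untl Φ Ψ => exact hx.elim
  | rels Φ Ψ => exact hx.elim

open Classical in
/-- The assignment to the propositional atoms of `xnf(⋀ χ)` by their actual truth values. -/
noncomputable def truthAssignment (w : World S) (z z' : Trace S) (χ : Set (TNF S)) :
    TNF S → Option Bool :=
  fun a => if ∃ Θ ∈ χ, a ∈ Θ.xnf.propAtoms then some (decide (a.Holds w z z')) else none

theorem truthAssignment_eq_true {w : World S} {z z' : Trace S} {χ : Set (TNF S)} {a : TNF S} :
    truthAssignment w z z' χ a = some true ↔
      (∃ Θ ∈ χ, a ∈ Θ.xnf.propAtoms) ∧ a.Holds w z z' := by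
  unfold truthAssignment
  split_ifs with h <;> simp [h]

theorem truthAssignment_eq_false {w : World S} {z z' : Trace S} {χ : Set (TNF S)} {a : TNF S} :
    truthAssignment w z z' χ a = some false ↔
      (∃ Θ ∈ χ, a ∈ Θ.xnf.propAtoms) ∧ ¬ a.Holds w z z' := by
  unfold truthAssignment
  split_ifs with h <;> simp [h]

/-- An `xnf` has no atoms of the form until or release, so the truth of the formula and of its
atoms is consistent with its propositional reading. -/
theorem isAssignment_truthAssignment {w : World S} {z z' : Trace S} {χ : Set (TNF S)}
    (h : ∀ Θ ∈ χ, Θ.Holds w z z') : IsAssignment χ (truthAssignment w z z' χ) := by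
  have key : ∀ Ψ : TNF S, Ψ.IsXnf → (∀ a ∈ Ψ.propAtoms, ∃ Θ ∈ χ, a ∈ Θ.xnf.propAtoms) →
      Ψ.Holds w z z' → PropSat (truthAssignment w z z' χ) Ψ := by
    intro Ψ hx hdom hΨ
    induction Ψ with
    | lit φ => exact truthAssignment_eq_true.2 ⟨hdom _ rfl, hΨ⟩
    | nlit φ => exact truthAssignment_eq_false.2 ⟨hdom _ rfl, hΨ⟩
    | tail => exact truthAssignment_eq_true.2 ⟨hdom _ rfl, hΨ⟩
    | ntail => exact truthAssignment_eq_false.2 ⟨hdom _ rfl, hΨ⟩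
    | and Φ Ψ ih₁ ih₂ =>
      exact ⟨ih₁ hx.1 (fun a ha => hdom a (.inl ha)) hΨ.1,
        ih₂ hx.2 (fun a ha => hdom a (.inr ha)) hΨ.2⟩
    | or Φ Ψ ih₁ ih₂ =>
      exact hΨ.imp (ih₁ hx.1 fun a ha => hdom a (.inl ha))
        (ih₂ hx.2 fun a ha => hdom a (.inr ha))
    | next Φ ih => exact truthAssignment_eq_true.2 ⟨hdom _ rfl, hΨ⟩
    | untl Φ Ψ => exact hx.elim
    | rels Φ Ψ => exact hx.elim
  refine ⟨fun a ha => ?_, fun Θ hΘ => ?_⟩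
  · by_contra hno
    exact ha (by simp only [truthAssignment, if_neg hno])
  · exact key _ (isXnf_xnf Θ) (fun a ha => ⟨Θ, hΘ, ha⟩) ((holds_xnf Θ z z').2 (h Θ hΘ))

/-- The fluent literals of the true assignment are true, and their sentences occur in `χ`. -/
theorem sat_of_mem_localPart_truthAssignment {w : World S} {z z' : Trace S} {χ : Set (TNF S)}
    (hfv : ∀ Θ ∈ χ, ∀ φ ∈ Θ.sentences, φ.fv = ∅) {ψ : Fml S}
    (hψ : ψ ∈ localPart (truthAssignment w z z' χ)) :
    ψ.Sat w z ∧ ∃ Θ ∈ χ, ψ ∈ Θ.sentences ∨ ∃ φ ∈ Θ.sentences, ψ = .neg φ := by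
  rcases hψ with hψ | ⟨φ, hψ, rfl⟩
  · obtain ⟨⟨Θ, hΘ, ha⟩, h⟩ := truthAssignment_eq_true.1 hψ
    exact ⟨h, Θ, hΘ, .inl (mem_sentences_of_mem_propAtoms ha)⟩
  · obtain ⟨⟨Θ, hΘ, ha⟩, h⟩ := truthAssignment_eq_false.1 hψ
    have hφ := mem_sentences_of_mem_propAtoms ha
    exact ⟨(Fml.sat_neg (hfv Θ hΘ φ hφ)).2 h, Θ, hΘ, .inr ⟨φ, hφ, rfl⟩⟩

/-- The formula `F Tail`. As long as it is among the obligations, every assignment has to decide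
`Tail`. -/
def evTail : TNF S := untl (lit .top) tail

theorem holds_evTail {w : World S} (z z' : Trace S) : (evTail : TNF S).Holds w z z' := by
  induction z' generalizing z with
  | nil => rfl
  | cons α z' ih => exact .inr ⟨Fml.sat_top, ih _⟩

end TNF

namespace NNF
variable {S : Signature}

/-- Truth of formulas in negation normal form on finite traces. -/
def Holds (w : World S) : NNF S → Trace S → Trace S → Prop
  | lit φ, z, _ => φ.Sat w z
  | nlit φ, z, _ => ¬ φ.Sat w z
  | and Φ Ψ, z, z' => Φ.Holds w z z' ∧ Ψ.Holds w z z'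
  | or Φ Ψ, z, z' => Φ.Holds w z z' ∨ Ψ.Holds w z z'
  | next Φ, z, z' => ∃ α z'', z' = α :: z'' ∧ Φ.Holds w (z ++ [α]) z''
  | wnext Φ, z, z' => ∀ α z'', z' = α :: z'' → Φ.Holds w (z ++ [α]) z''
  | untl Φ Ψ, z, z' => UntilOn (Φ.Holds w) (Ψ.Holds w) z z'
  | rels Φ Ψ, z, z' =>
      ¬ UntilOn (fun z z' => ¬ Φ.Holds w z z') (fun z z' => ¬ Ψ.Holds w z z') z z'

theorem holds_toTNF {w : World S} (Θ : NNF S) (z z' : Trace S) :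
    Θ.toTNF.Holds w z z' ↔ Θ.Holds w z z' := by
  induction Θ generalizing z z' with
  | lit φ => rfl
  | nlit φ => rfl
  | and Φ Ψ ih₁ ih₂ => simp only [toTNF, Holds, TNF.Holds, ih₁, ih₂]
  | or Φ Ψ ih₁ ih₂ => simp only [toTNF, Holds, TNF.Holds, ih₁, ih₂]
  | next Φ ih => cases z' <;> simp [toTNF, Holds, TNF.Holds, ih]
  | wnext Φ ih => cases z' <;> simp [toTNF, Holds, TNF.Holds, ih]
  | untl Φ Ψ ih₁ ih₂ =>
    simp only [toTNF, Holds, TNF.Holds]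
    exact untilOn_congr (fun z α z' => by simp [ih₁]) ih₂ z z'
  | rels Φ Ψ ih₁ ih₂ =>
    simp only [toTNF, Holds, TNF.Holds]
    simp only [ih₁, ih₂]
    induction z' generalizing z with
    | nil => simp [UntilOn]
    | cons α z' ih => simp [UntilOn, ih, ih₂]; tauto

end NNF

namespace Goal
variable {S : Signature}

theorem holds_nnf {w : World S} (Φ : Goal S) (z z' : Trace S) :
    ((Φ.nnf true).Holds w z z' ↔ Φ.Sat w z z') ∧
      ((Φ.nnf false).Holds w z z' ↔ ¬ Φ.Sat w z z') := by
  induction Φ generalizing z z' with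
  | atom φ => exact ⟨Iff.rfl, Iff.rfl⟩
  | neg Φ ih =>
    simp only [nnf, Sat, not_not]
    exact ⟨(ih z z').2, (ih z z').1⟩
  | and Φ Ψ ih₁ ih₂ =>
    simp only [nnf, NNF.Holds, Sat, (ih₁ z z').1, (ih₂ z z').1, (ih₁ z z').2, (ih₂ z z').2]
    tauto
  | next Φ ih =>
    simp only [nnf, NNF.Holds, Sat, (ih _ _).1, (ih _ _).2]
    refine ⟨trivial, ?_⟩
    push Not
    rfl
  | untl Φ Ψ ih₁ ih₂ =>
    simp only [nnf, NNF.Holds, sat_untl, (ih₁ _ _).2, (ih₂ _ _).2, not_not]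
    exact ⟨untilOn_congr (fun z α z' => (ih₁ _ _).1) (fun z z' => (ih₂ _ _).1) z z', trivial⟩

/-- A formula and its tail normal form agree on finite traces. -/
theorem holds_tnf {w : World S} (Φ : Goal S) (z z' : Trace S) :
    Φ.tnf.Holds w z z' ↔ Φ.Sat w z z' := by
  change (Φ.nnf true).toTNF.Holds w z z' ∧ TNF.evTail.Holds w z z' ↔ _
  rw [NNF.holds_toTNF, (Φ.holds_nnf z z').1, and_iff_left (TNF.holds_evTail z z')]

theorem isC2Sentence_of_mem_sentences {Φ : Goal S} (hΦ : Φ.IsC2) {φ : Fml S}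
    (h : φ ∈ Φ.tnf.sentences) : φ.IsC2Sentence := by
  have key : ∀ Φ : Goal S, Φ.IsC2 → ∀ b, ∀ φ ∈ (Φ.nnf b).toTNF.sentences, φ.IsC2Sentence := by
    intro Φ hΦ
    induction Φ with
    | atom φ =>
      rintro (_ | _) ψ hψ <;> obtain rfl : ψ = φ := hψ <;> exact hΦ
    | neg Φ ih =>
      intro b
      have := ih hΦ (!b)
      cases b <;> exact this
    | and Φ Ψ ih₁ ih₂ =>
      rintro (_ | _) ψ (hψ | hψ)
      exacts [ih₁ hΦ.1 _ ψ hψ, ih₂ hΦ.2 _ ψ hψ, ih₁ hΦ.1 _ ψ hψ, ih₂ hΦ.2 _ ψ hψ]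
    | next Φ ih =>
      rintro (_ | _) ψ (hψ | hψ)
      exacts [hψ.elim, ih hΦ _ ψ hψ, hψ.elim, ih hΦ _ ψ hψ]
    | untl Φ Ψ ih₁ ih₂ =>
      rintro (_ | _) ψ ((hψ | hψ) | hψ)
      exacts [hψ.elim, ih₁ hΦ.1 _ ψ hψ, ih₂ hΦ.2 _ ψ hψ, hψ.elim, ih₁ hΦ.1 _ ψ hψ,
        ih₂ hΦ.2 _ ψ hψ]
  rcases h with h | h | h
  · exact key Φ hΦ true φ h
  · obtain rfl : φ = .top := h
    exact Fml.isC2Sentence_top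
  · exact h.elim

end Goal

/-! ### Context sentences and types -/

theorem Prog.finite_guards {S : Signature} (δ : Prog S) :
    {ψ | ∃ α ρ, Prog.Edge δ α ψ ρ}.Finite := by
  induction δ with
  | act α =>
    refine (Set.finite_singleton Fml.top).subset ?_
    rintro ψ ⟨β, ρ, h⟩
    cases h
    rfl
  | test φ =>
    refine Set.finite_empty.subset ?_
    rintro ψ ⟨β, ρ, h⟩
    cases h
  | seq δ₁ δ₂ ih₁ ih₂ =>
    refine (ih₁.union (ih₂.image (Fml.and δ₁.term))).subset ?_
    rintro ψ ⟨β, ρ, h⟩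
    cases h with
    | seq_left h => exact .inl ⟨_, _, h⟩
    | seq_right h => exact .inr ⟨_, ⟨_, _, h⟩, rfl⟩
  | choice δ₁ δ₂ ih₁ ih₂ =>
    refine (ih₁.union ih₂).subset ?_
    rintro ψ ⟨β, ρ, h⟩
    cases h with
    | choice_left h => exact .inl ⟨_, _, h⟩
    | choice_right h => exact .inr ⟨_, _, h⟩
  | par δ₁ δ₂ ih₁ ih₂ =>
    refine (ih₁.union ih₂).subset ?_
    rintro ψ ⟨β, ρ, h⟩
    cases h with
    | par_left h => exact .inl ⟨_, _, h⟩
    | par_right h => exact .inr ⟨_, _, h⟩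
  | star δ ih =>
    refine ih.subset ?_
    rintro ψ ⟨β, ρ, h⟩
    cases h with
    | star h => exact ⟨_, _, h⟩

namespace GologProgram
variable {S : Signature} (G : GologProgram S) (Φ : Goal S)

theorem finite_contextBase : (G.contextBase Φ).Finite := by
  refine ((((Finset.finite_toSet _).union ?_).union ?_).union ?_).union (TNF.finite_sentences _)
  · refine (Set.finite_iUnion fun F : S.Flu => G.prog.finite_actions.biUnion fun α _ =>
      (((G.bat.groundPos F α ++ G.bat.groundNeg F α).map Prod.snd).finite_toSet)).subset ?_
    rintro ψ ⟨F, α, hα, ε, h⟩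
    refine Set.mem_iUnion.2 ⟨F, Set.mem_biUnion hα ?_⟩
    simp only [Set.mem_ofPred_eq, List.mem_map, List.mem_append]
    exact ⟨(ε, ψ), h, rfl⟩
  · refine (G.prog.finite_sub.image Prog.term).subset ?_
    rintro ψ ⟨ρ, hρ, rfl⟩
    exact ⟨ρ, hρ, rfl⟩
  · refine (G.prog.finite_sub.biUnion fun ρ _ => ρ.finite_guards).subset ?_
    rintro ψ ⟨ρ, hρ, h⟩
    exact Set.mem_biUnion hρ h

theorem finite_context : (G.context Φ).Finite := by
  refine (G.finite_contextBase Φ).union (((G.finite_contextBase Φ).image Fml.neg).subset ?_)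
  rintro ψ ⟨φ, hφ, rfl⟩
  exact ⟨φ, hφ, rfl⟩

theorem finite_typeElements : (G.typeElements Φ).Finite :=
  ((G.finite_context Φ).prod G.finite_relEffects.finite_finsets_subset).subset
    fun _ hp => ⟨hp.1, hp.2⟩

theorem finite_isState : {s : ArenaState S | G.IsState Φ s}.Finite := by
  have hty := (G.finite_typeElements Φ).finite_subsets
  have heff := G.finite_relEffects.finite_finsets_subset
  have hobl := ((TNF.finite_cl Φ.tnf).finite_subsets.prod
    (Set.finite_univ (α := Bool))).finite_subsets
  refine (((hty.prod heff).prod (hobl.prod G.prog.finite_sub)).image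
    fun p => ArenaState.mk p.1.1 p.1.2 p.2.1 p.2.2).subset ?_
  rintro ⟨τ, E, A, ρ⟩ ⟨hτ, hρ, hE, hA⟩
  exact ⟨((τ, E), (A, ρ)), ⟨⟨hτ.1, hE⟩, fun a ha => ⟨hA a ha, trivial⟩, hρ⟩, rfl⟩

variable {G Φ}

theorem isC2Sentence_of_mem_contextBase (hΦ : Φ.IsC2) {ψ : Fml S} (h : ψ ∈ G.contextBase Φ) :
    ψ.IsC2Sentence := by
  rcases h with (((h | ⟨F, α, -, ε, h⟩) | ⟨ρ, hρ, rfl⟩) | ⟨ρ, hρ, α, ρ', h⟩) | h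
  · exact G.bat.initial_c2 ψ h
  · exact BAT.isC2Sentence_of_mem_ground (p := (ε, ψ)) h
  · exact Prog.isC2Sentence_term (Prog.testsC2_of_mem_sub G.tests_c2 hρ)
  · exact (h.isC2 (Prog.testsC2_of_mem_sub G.tests_c2 hρ)).1
  · exact Goal.isC2Sentence_of_mem_sentences hΦ h

theorem isC2Sentence_of_mem_context (hΦ : Φ.IsC2) {ψ : Fml S} (h : ψ ∈ G.context Φ) :
    ψ.IsC2Sentence := by
  rcases h with h | ⟨φ, h, rfl⟩
  · exact isC2Sentence_of_mem_contextBase hΦ h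
  · exact (isC2Sentence_of_mem_contextBase hΦ h).neg

theorem isC2Sentence_regress (hΦ : Φ.IsC2) {ψ : Fml S} (h : ψ ∈ G.context Φ)
    {E : Finset (Effect S)} (hE : ↑E ⊆ G.relEffects) : (regress E ψ).IsC2Sentence :=
  (isC2Sentence_of_mem_context hΦ h).regress (G.isWF_of_subset_relEffects hE)

theorem isType_typeOf (hΦ : Φ.IsC2) {w : World S} (hw : G.bat.Models w) :
    G.IsType Φ (G.typeOf Φ w) := by
  refine ⟨fun p hp => hp.1, fun ψ hψ E hE => ?_, w, hw.1, fun p hp => hp.2⟩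
  by_cases h : (regress E ψ).Sat w []
  · exact .inl ⟨⟨.inl hψ, hE⟩, h⟩
  · exact .inr ⟨⟨.inr ⟨ψ, hψ, rfl⟩, hE⟩,
      (Fml.sat_neg (isC2Sentence_regress hΦ (.inl hψ) hE).1).2 h⟩

end GologProgram

/-! ### Arena states and configurations -/

theorem applyEffects_congr {S : Signature} {w w' : World S} {z z' : Trace S}
    (h : ∀ F n, w F n z ↔ w' F n z') (E : Finset (Effect S)) (F : S.Flu)
    (n : Fin (S.fluArity F) → S.Obj) : applyEffects E w F n z ↔ applyEffects E w' F n z' := by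
  simp only [applyEffects, h, Fml.holds_congr_world h]

theorem obligations_subset_cl {S : Signature} {Φ : Goal S}
    {τ : Set (Fml S × Finset (Effect S))} {E : Finset (Effect S)} {C : Set (Set (TNF S))}
    (hC : ∀ χ ∈ C, χ ⊆ Φ.tnf.cl) : ∀ a ∈ obligations τ E C, a.1 ⊆ Φ.tnf.cl := by
  rintro a ⟨χ, hχ, P, hP, -, rfl⟩
  exact hP.nextPart_subset fun Θ hΘ => TNF.cl_subset (hC χ hχ hΘ)

namespace GologProgram
variable {S : Signature} {G : GologProgram S} {Φ : Goal S} {w : World S} {z z' : Trace S}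
  {s s' : ArenaState S} {α : GroundAction S}

/-- The state `s` abstracts a configuration of the world `w` after the trace `z`: its type is that
of `w`, and its effects turn the initial situation of `w` into the situation `z`. -/
structure Represents (G : GologProgram S) (Φ : Goal S) (w : World S) (z : Trace S)
    (s : ArenaState S) : Prop where
  ty_eq : s.ty = G.typeOf Φ w
  eff_subset : ↑s.eff ⊆ G.relEffects
  prog_mem : s.prog ∈ G.prog.sub
  apply_eff : ∀ F n, applyEffects s.eff w F n [] ↔ w F n z

theorem Represents.sat_regress_iff (h : G.Represents Φ w z s) (ψ : Fml S) :
    (regress s.eff ψ).Sat w [] ↔ ψ.Sat w z :=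
  forall_congr' fun e => (holds_regress (G.isWF_of_subset_relEffects h.eff_subset) ψ e).trans
    (Fml.holds_congr_world h.apply_eff ψ e)

theorem Represents.sat_of_mem (h : G.Represents Φ w z s) {ψ : Fml S} (hψ : (ψ, s.eff) ∈ s.ty) :
    ψ.Sat w z := by
  rw [h.ty_eq] at hψ
  exact (h.sat_regress_iff ψ).1 hψ.2

/-- The type and the effects of a state decide which sentences of the context are true. -/
theorem Represents.mem_iff (h : G.Represents Φ w z s) {ψ : Fml S} (hψ : ψ ∈ G.context Φ) :
    (ψ, s.eff) ∈ s.ty ↔ ψ.Sat w z := by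
  refine ⟨h.sat_of_mem, fun hs => ?_⟩
  rw [h.ty_eq]
  exact ⟨⟨hψ, h.eff_subset⟩, (h.sat_regress_iff ψ).2 hs⟩

theorem Represents.isFinal_iff (h : G.Represents Φ w z s) :
    s.IsFinal ↔ Prog.Final w z s.prog := by
  rw [Prog.final_iff_term (Prog.testsC2_of_mem_sub G.tests_c2 h.prog_mem)]
  exact h.mem_iff (.inl (.inl (.inl (.inr ⟨_, h.prog_mem, rfl⟩))))

theorem Represents.mem_actions (h : G.Represents Φ w z s) {ψ : Fml S} {ρ : Prog S}
    (he : Prog.Edge s.prog α ψ ρ) : α ∈ G.prog.actions :=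
  Prog.actions_subset_of_mem_sub h.prog_mem he.mem_actions.1

theorem Represents.guard_mem_context (h : G.Represents Φ w z s) {ψ : Fml S} {ρ : Prog S}
    (he : Prog.Edge s.prog α ψ ρ) : ψ ∈ G.context Φ :=
  .inl (.inl (.inr ⟨_, h.prog_mem, α, ρ, he⟩))

/-- The accumulated effects keep track of the current situation. -/
theorem Represents.step (hG : G.bat.Acyclic) (hw : G.bat.Models w) (h : G.Represents Φ w z s)
    {ψ : Fml S} (he : Prog.Edge s.prog α ψ s'.prog) (hty : s'.ty = s.ty)
    (heff : s'.eff = accumulate s.eff (G.execEffects s.ty s.eff α)) :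
    G.Represents Φ w (z ++ [α]) s' where
  ty_eq := hty.trans h.ty_eq
  eff_subset := by
    rw [heff]
    exact accumulate_subset_relEffects hG h.eff_subset (h.mem_actions he)
  prog_mem := Prog.sub_step h.prog_mem he
  apply_eff F n := by
    rw [heff, applyEffects_accumulate (G.isWF_of_subset_relEffects h.eff_subset),
      applyEffects_congr h.apply_eff]
    refine applyEffects_execEffects hw (fun F p hp => h.mem_iff ?_) F n
    exact .inl (.inl (.inl (.inl (.inr ⟨F, α, h.mem_actions he, p.1, hp⟩))))

/-- Every transition of the arena comes from one of the represented configuration. -/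
theorem Represents.of_arenaTrans (hG : G.bat.Acyclic) (hw : G.bat.Models w)
    (h : G.Represents Φ w z s) (ht : G.ArenaTrans Φ s α s') :
    Prog.Trans w (z, s.prog) (z ++ [α], s'.prog) ∧ G.Represents Φ w (z ++ [α]) s' := by
  obtain ⟨-, -, hty, ⟨ψ, he, hψ⟩, heff, -⟩ := ht
  exact ⟨he.trans (Prog.testsC2_of_mem_sub G.tests_c2 h.prog_mem) (h.sat_of_mem hψ),
    h.step hG hw he hty.symm heff⟩

/-- Every transition of the represented configuration has a counterpart in the arena. The effects
of the successor are relevant and its obligations are subformulas, so that it is a state. -/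
theorem Represents.exists_arenaTrans (hG : G.bat.Acyclic) (hw : G.bat.Models w)
    (h : G.Represents Φ w z s) (hs : G.IsState Φ s) {ρ : Prog S}
    (ht : Prog.Trans w (z, s.prog) (z', ρ)) :
    ∃ α s', z' = z ++ [α] ∧ s'.prog = ρ ∧ G.ArenaTrans Φ s α s' := by
  obtain ⟨α, ψ, rfl, he, hψ⟩ :=
    ht.exists_edge (Prog.testsC2_of_mem_sub G.tests_c2 h.prog_mem)
  let E := accumulate s.eff (G.execEffects s.ty s.eff α)
  let s' : ArenaState S := ⟨s.ty, E, obligations s.ty E {χ | (χ, false) ∈ s.obl}, ρ⟩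
  have h' : G.Represents Φ w (z ++ [α]) s' := h.step hG hw he rfl rfl
  refine ⟨α, s', rfl, rfl, hs, ⟨hs.1, h'.prog_mem, h'.eff_subset, ?_⟩, rfl,
    ⟨ψ, he, (h.mem_iff (h.guard_mem_context he)).2 hψ⟩, rfl, rfl⟩
  exact obligations_subset_cl fun χ hχ => hs.2.2.2 _ hχ

theorem represents_of_isInitialState (h : G.IsInitialState Φ s) (hty : s.ty = G.typeOf Φ w) :
    G.Represents Φ w [] s where
  ty_eq := hty
  eff_subset := h.1.2.2.1
  prog_mem := h.1.2.1
  apply_eff F n := by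
    rw [h.2.2.2.1]
    exact applyEffects_empty w F n []

theorem exists_isInitialState (hΦ : Φ.IsC2) (hw : G.bat.Models w) :
    ∃ s, G.IsInitialState Φ s ∧ s.ty = G.typeOf Φ w := by
  refine ⟨⟨G.typeOf Φ w, ∅, obligations (G.typeOf Φ w) ∅ {{Φ.tnf}}, G.prog⟩,
    ⟨⟨isType_typeOf hΦ hw, Prog.self_mem_sub _, by simp, ?_⟩, ⟨w, hw, rfl⟩, rfl, rfl, rfl⟩, rfl⟩
  refine obligations_subset_cl fun χ hχ => ?_
  obtain rfl : χ = {Φ.tnf} := hχ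
  simpa using TNF.self_mem_cl _

/-! ### Paths of the arena and executions -/

/-- Paths of the arena, with the trace of their actions. -/
inductive ArenaPath (G : GologProgram S) (Φ : Goal S) :
    ArenaState S → Trace S → ArenaState S → Prop
  | nil {s : ArenaState S} : ArenaPath G Φ s [] s
  | cons {s s' s'' : ArenaState S} {α : GroundAction S} {z : Trace S} : G.ArenaTrans Φ s α s' →
      ArenaPath G Φ s' z s'' →
      ArenaPath G Φ s (α :: z) s''

theorem isReachable_iff : G.IsReachable Φ s ↔
    ∃ s₀ z, G.IsInitialState Φ s₀ ∧ G.ArenaPath Φ s₀ z s := by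
  constructor
  · rintro ⟨s₀, h₀, h⟩
    suffices ∃ z, G.ArenaPath Φ s₀ z s by
      obtain ⟨z, hz⟩ := this
      exact ⟨s₀, z, h₀, hz⟩
    clear h₀
    induction h using Relation.ReflTransGen.head_induction_on with
    | refl => exact ⟨[], .nil⟩
    | head h _ ih =>
      obtain ⟨α, h⟩ := h
      obtain ⟨z, hz⟩ := ih
      exact ⟨α :: z, .cons h hz⟩
  · rintro ⟨s₀, z, h₀, h⟩
    refine ⟨s₀, h₀, ?_⟩
    clear h₀
    induction h with
    | nil => exact .refl
    | cons h _ ih => exact .head ⟨_, h⟩ ih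

theorem ArenaPath.execution (hG : G.bat.Acyclic) (hw : G.bat.Models w)
    (hp : G.ArenaPath Φ s z' s') (h : G.Represents Φ w z s) :
    Relation.ReflTransGen (Prog.Trans w) (z, s.prog) (z ++ z', s'.prog) ∧
      G.Represents Φ w (z ++ z') s' := by
  induction hp generalizing z with
  | nil => simpa using ⟨.refl, h⟩
  | cons ht _ ih =>
    obtain ⟨ht, h'⟩ := h.of_arenaTrans hG hw ht
    have := ih h'
    rw [List.append_assoc] at this
    exact ⟨.head ht this.1, this.2⟩

theorem exists_arenaPath (hG : G.bat.Acyclic) (hw : G.bat.Models w) {c c' : Trace S × Prog S}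
    (hr : Relation.ReflTransGen (Prog.Trans w) c c') :
    ∀ s, s.prog = c.2 → G.IsState Φ s → G.Represents Φ w c.1 s →
      ∃ z' s', c' = (c.1 ++ z', s'.prog) ∧ G.ArenaPath Φ s z' s' := by
  induction hr using Relation.ReflTransGen.head_induction_on with
  | refl =>
    rintro s hs - -
    exact ⟨[], s, by simp [hs], .nil⟩
  | @head c c₁ ht _ ih =>
    intro s hs hst h
    obtain ⟨z, ρ⟩ := c
    obtain ⟨z₁, ρ₁⟩ := c₁
    subst hs
    obtain ⟨α, s₁, rfl, rfl, ha⟩ := h.exists_arenaTrans hG hw hst ht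
    obtain ⟨z', s', rfl, hp⟩ := ih s₁ rfl ha.2.1 (h.of_arenaTrans hG hw ha).2
    exact ⟨α :: z', s', by simp, .cons ha hp⟩

/-! ### Acceptance -/

/-- If a path leads to an accepting state, then all formulas of one of the initial sets of
obligations are true on the trace of the path. -/
theorem ArenaPath.exists_holds_of_isAccepting (hG : G.bat.Acyclic) (hw : G.bat.Models w)
    (hp : G.ArenaPath Φ s z' s') (h : G.Represents Φ w z s) {C : Set (Set (TNF S))}
    (hC : s.obl = obligations s.ty s.eff C) (hacc : s'.IsAccepting) :
    ∃ χ ∈ C, ∀ Θ ∈ χ, Θ.Holds w z z' := by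
  have hneg : ∀ z (φ : Fml S), (Fml.neg φ).Sat w z → ¬ φ.Sat w z := by
    intro z φ h₁ h₂
    obtain ⟨e⟩ : Nonempty (ℕ → S.Obj) := inferInstance
    exact h₁ e (h₂ e)
  induction hp generalizing z C with
  | nil =>
    rw [ArenaState.IsAccepting, hC] at hacc
    obtain ⟨χ, hχ, P, hP, hloc, heq⟩ := hacc
    obtain ⟨hnext, htail⟩ := Prod.mk.inj heq
    refine ⟨χ, hχ, fun Θ hΘ => (TNF.holds_xnf Θ z []).1 ?_⟩
    refine TNF.holds_of_propSat (fun ψ hψ => h.sat_of_mem (hloc ψ hψ)) (hneg z)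
      (by simp [← htail]) ?_ (TNF.isXnf_xnf Θ) (hP.2 Θ hΘ)
    simp [← hnext]
  | cons ht _ ih =>
    obtain ⟨χ', hχ', hholds⟩ := ih (h.of_arenaTrans hG hw ht).2 ht.2.2.2.2.2 hacc
    rw [Set.mem_ofPred_eq, hC] at hχ'
    obtain ⟨χ, hχ, P, hP, hloc, heq⟩ := hχ'
    obtain ⟨hnext, htail⟩ := Prod.mk.inj heq
    refine ⟨χ, hχ, fun Θ hΘ => (TNF.holds_xnf Θ z _).1 ?_⟩
    refine TNF.holds_of_propSat (fun ψ hψ => h.sat_of_mem (hloc ψ hψ)) (hneg z)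
      (by simp [← htail]) ?_ (TNF.isXnf_xnf Θ) (hP.2 Θ hΘ)
    intro Ψ hΨ
    exact ⟨_, _, rfl, hholds Ψ (hnext ▸ hΨ)⟩

/-- If all formulas of one of the initial sets of obligations are true on the trace of a path, then
choosing the true assignment at every position leads to acceptance. The set must contain `F Tail`,
possibly inside the tail normal form, so that `Tail` gets a value. -/
theorem ArenaPath.isAccepting_of_holds (hΦ : Φ.IsC2) (hG : G.bat.Acyclic) (hw : G.bat.Models w)
    (hp : G.ArenaPath Φ s z' s') (h : G.Represents Φ w z s) {C : Set (Set (TNF S))}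
    (hC : s.obl = obligations s.ty s.eff C) {χ : Set (TNF S)} (hχ : χ ∈ C) (hcl : χ ⊆ Φ.tnf.cl)
    (htail : TNF.evTail ∈ χ ∨ Φ.tnf ∈ χ) (hholds : ∀ Θ ∈ χ, Θ.Holds w z z') :
    s'.IsAccepting := by
  have hatoms : ∀ {χ : Set (TNF S)}, TNF.evTail ∈ χ ∨ Φ.tnf ∈ χ →
      ∀ a ∈ ({.tail, .next .evTail} : Set (TNF S)), ∃ Θ ∈ χ, a ∈ Θ.xnf.propAtoms := by
    rintro χ hχ a ha
    have ha' : a ∈ (TNF.evTail : TNF S).xnf.propAtoms := by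
      rcases ha with rfl | rfl
      · exact .inl rfl
      · exact .inr (.inr rfl)
    rcases hχ with h | h
    · exact ⟨_, h, ha'⟩
    · exact ⟨_, h, .inr ha'⟩
  have hmem : ∀ {z z' : Trace S} {s : ArenaState S} {C : Set (Set (TNF S))} {χ : Set (TNF S)},
      G.Represents Φ w z s → s.obl = obligations s.ty s.eff C → χ ∈ C → χ ⊆ Φ.tnf.cl →
      (∀ Θ ∈ χ, Θ.Holds w z z') →
      (TNF.nextPart (TNF.truthAssignment w z z' χ),
        TNF.tailPart (TNF.truthAssignment w z z' χ)) ∈ s.obl := by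
    intro z z' s C χ h hC hχ hcl hholds
    rw [hC]
    refine ⟨χ, hχ, _, TNF.isAssignment_truthAssignment hholds, fun ψ hψ => ?_, rfl⟩
    have hsub : ∀ Θ ∈ χ, Θ.sentences ⊆ Φ.tnf.sentences :=
      fun Θ hΘ => TNF.sentences_subset (hcl hΘ)
    obtain ⟨hs, Θ, hΘ, hor⟩ := TNF.sat_of_mem_localPart_truthAssignment
      (fun Θ hΘ φ hφ => (Goal.isC2Sentence_of_mem_sentences hΦ (hsub Θ hΘ hφ)).1) hψ
    refine (h.mem_iff ?_).2 hs
    rcases hor with h | ⟨φ, hφ, rfl⟩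
    · exact .inl (.inr (hsub Θ hΘ h))
    · exact .inr ⟨φ, .inr (hsub Θ hΘ hφ), rfl⟩
  induction hp generalizing z C χ with
  | nil =>
    have := hmem h hC hχ hcl hholds
    have hX : TNF.nextPart (TNF.truthAssignment w z [] χ) = ∅ := by
      refine Set.eq_empty_of_forall_notMem fun Θ hΘ => ?_
      obtain ⟨-, α, z', h, -⟩ := TNF.truthAssignment_eq_true.1 hΘ
      simp at h
    have hT : TNF.tailPart (TNF.truthAssignment w z [] χ) = true :=
      decide_eq_true (TNF.truthAssignment_eq_true.2 ⟨hatoms htail _ (.inl rfl), rfl⟩)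
    rwa [hX, hT] at this
  | @cons s s₁ s' α z' ht _ ih =>
    have := hmem h hC hχ hcl hholds
    have hT : TNF.tailPart (TNF.truthAssignment w z (α :: z') χ) = false := by
      refine decide_eq_false fun h => ?_
      have := (TNF.truthAssignment_eq_true.1 h).2
      simp [TNF.Holds] at this
    rw [hT] at this
    refine ih (h.of_arenaTrans hG hw ht).2 ht.2.2.2.2.2 this (ht.1.2.2.2 _ this) (.inl ?_) ?_
    · exact TNF.truthAssignment_eq_true.2
        ⟨hatoms htail _ (.inr rfl), α, z', rfl, TNF.holds_evTail _ _⟩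
    · intro Θ hΘ
      obtain ⟨-, β, z'', heq, hh⟩ := TNF.truthAssignment_eq_true.1 hΘ
      obtain ⟨rfl, rfl⟩ := List.cons.inj heq
      exact hh

/-- A path from the initial state of a world ends in an accepting state iff its trace satisfies the
temporal formula. -/
theorem ArenaPath.isAccepting_iff (hΦ : Φ.IsC2) (hG : G.bat.Acyclic) (hw : G.bat.Models w)
    (hi : G.IsInitialState Φ s) (hty : s.ty = G.typeOf Φ w) (hp : G.ArenaPath Φ s z' s') :
    s'.IsAccepting ↔ Φ.Sat w [] z' := by
  have h := represents_of_isInitialState hi hty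
  have hobl := hi.2.2.2.2
  rw [← Goal.holds_tnf]
  constructor
  · intro hacc
    obtain ⟨χ, rfl, hχ⟩ := hp.exists_holds_of_isAccepting hG hw h hobl hacc
    exact hχ _ rfl
  · intro hs
    refine hp.isAccepting_of_holds hΦ hG hw h hobl (Set.mem_singleton _) ?_ (.inr rfl) ?_
    · simpa using TNF.self_mem_cl _
    · simpa using hs

end GologProgram

theorem mainTheorem1 (S : Signature) (G : GologProgram S) (Φ : Goal S) (hΦ : Φ.IsC2)
    (hacyclic : G.bat.Acyclic) (hdet : G.SituationDetermined) :
    {s : ArenaState S | G.IsState Φ s}.Finite ∧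
    (∀ ψ ∈ G.context Φ, ∀ E : Finset (Effect S), ↑E ⊆ G.relEffects →
      (regress E ψ).IsC2Sentence) ∧
    (G.AllExecutionsSatisfy Φ ↔ ∀ s, G.IsReachable Φ s → s.IsFinal → s.IsAccepting) := by
  refine ⟨G.finite_isState Φ, fun ψ hψ E hE => GologProgram.isC2Sentence_regress hΦ hψ hE, ?_, ?_⟩
  · intro hall s hs hfin
    obtain ⟨s₀, z, hi, hp⟩ := GologProgram.isReachable_iff.1 hs
    obtain ⟨w, hw, hty⟩ := hi.2.1
    have h₀ := GologProgram.represents_of_isInitialState hi hty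
    obtain ⟨hr, h⟩ := hp.execution hacyclic hw h₀
    rw [hi.2.2.1] at hr
    exact (hp.isAccepting_iff hΦ hacyclic hw hi hty).2
      (hall w hw z ⟨s.prog, hr, h.isFinal_iff.1 hfin⟩)
  · rintro hacc w hw z ⟨ρ, hr, hfin⟩
    obtain ⟨s₀, hi, hty⟩ := GologProgram.exists_isInitialState hΦ hw
    have h₀ := GologProgram.represents_of_isInitialState hi hty
    obtain ⟨z', s, heq, hp⟩ := GologProgram.exists_arenaPath hacyclic hw hr s₀ hi.2.2.1 hi.1 h₀
    obtain ⟨hz, rfl⟩ := Prod.mk.inj heq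
    obtain rfl : z = z' := by simpa using hz
    have h := (hp.execution hacyclic hw h₀).2
    exact (hp.isAccepting_iff hΦ hacyclic hw hi hty).1
      (hacc s (GologProgram.isReachable_iff.2 ⟨s₀, z, hi, hp⟩) (h.isFinal_iff.2 hfin))
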